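/- Let $n\ge 1$, let $g:\mathbb C\to\mathbb C$ be Borel measurable, and let $T_g(f):=g\circ f$ for complex-valued functions $f$ on $\mathbb R^n$. For $a\in\mathbb R^n$ and $r>0$ let $Q_r(a)$ be the open cube with centre $a$, side length $r$ (an "$r$-cube") and sides parallel to the coordinate axes, and let $Q_0:=(0,1)^n$. Put $f_Q:=\frac1{|Q|}\int_Q f$ and $M(f,Q):=\frac1{|Q|}\int_Q|f-f_Q|\,dx$. For $\varepsilon\in(0,1)$ and $\Omega\in\{\mathbb R^n,Q_0\}$ let $$[f]_{\varepsilon,\Omega}:=\sup_{\mathcal F}\ \varepsilon^{n-1}\sum_{Q\in\mathcal F}M(f,Q),$$ where the supremum is over all collections $\mathcal F$ of mutually disjoint axis-parallel $\varepsilon$-cubes contained in $\Omega$ with $\#\mathcal F\le 1/\varepsilon^{n-1}$. Let - $B(\mathbb R^n)$ be the set of all complex-valued $f\in L^1_{\rm loc}(\mathbb R^n)$ with $\|f\|_{B(\mathbb R^n)}:=\sup_{a\in\mathbb R^n}\int_{Q_1(a)}|f|\,dx+\sup_{0<\varepsilon<1}[f]_{\varepsilon,\mathbb R^n}<\infty$;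 - $B(Q_0)$ be the set of all complex-valued measurable $f$ on $\mathbb R^n$, integrable on $Q_0$, with $\|f\|_{B(Q_0)}:=\int_{Q_0}|f|\,dx+\sup_{0<\varepsilon<1}[f]_{\varepsilon,Q_0}<\infty$; - $B_c(\Omega)$ be the closure of $C_c^\infty(\Omega)$ in $B(\Omega)$, and $B_0(\Omega)$ the set of all $f\in B(\Omega)$ with $\limsup_{\varepsilon\to0}[f]_{\varepsilon,\Omega}=0$, for $\Omega\in\{\mathbb R^n,Q_0\}$. Then the following five statements are equivalent: 1. $g$ is uniformly continuous on $\mathbb C$; 2. $T_g(B_0(\mathbb R^n))\subset B_0(\mathbb R^n)$; 3. $T_g(B_c(\mathbb R^n))\subset B_0(\mathbb R^n)$; 4. $T_g(B_0(Q_0))\subset B_0(Q_0)$; 5. $T_g(B_c(Q_0))\subset B_0(Q_0)$. Moreover, if any of these holds, then $T_g$ maps bounded subsets of $B_0(\mathbb R^n)$ to bounded subsets of $B_0(\mathbb R^n)$, and bounded subsets of $B_0(Q_0)$ to bounded subsets of $B_0(Q_0)$ (boundedness with respect to $\|\cdot\|_{B(\mathbb R^n)}$ and $\|\cdot\|_{B(Q_0)}$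 respectively). -/

import Mathlib

open MeasureTheory Set Filter Topology
open scoped ENNReal NNReal ContDiff

noncomputable section

namespace BBM

/-- The open cube `Q_r(a)` in `ℝⁿ`, with centre `a`, side length `r` and sides parallel to the
coordinate axes. -/
def cube {n : ℕ} (a : Fin n → ℝ) (r : ℝ) : Set (Fin n → ℝ) :=
  {x | ∀ i, |x i - a i| < r / 2}

/-- The open unit cube `Q₀ = (0,1)ⁿ`. -/
def unitCube (n : ℕ) : Set (Fin n → ℝ) :=
  {x | ∀ i, 0 < x i ∧ x i < 1}

/-- The mean oscillation `M(f,Q) = ⨍_Q |f - f_Q|` (it is used only where `f` is integrable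
on `Q`). -/
def meanOsc {n : ℕ} (f : (Fin n → ℝ) → ℂ) (Q : Set (Fin n → ℝ)) : ℝ≥0∞ :=
  ⨍⁻ x in Q, ‖f x - ⨍ y in Q, f y ∂volume‖ₑ ∂volume

/-- The finite set `S` of centres describes a collection of mutually disjoint `ε`-cubes contained
in `Ω`, with sides parallel to the coordinate axes and cardinality at most `1 / ε ^ (n - 1)`. -/
def IsAdmissible {n : ℕ} (Ω : Set (Fin n → ℝ)) (ε : ℝ) (S : Finset (Fin n → ℝ)) : Prop :=
  (∀ a ∈ S, cube a ε ⊆ Ω) ∧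
  (S : Set (Fin n → ℝ)).PairwiseDisjoint (fun a => cube a ε) ∧
  (S.card : ℝ) ≤ 1 / ε ^ (n - 1)

/-- The quantity `[f]_{ε,Ω}`; `Ω = Q₀` gives `[f]_{ε,Q₀}` and `Ω = ℝⁿ` gives `[f]_ε`. -/
def bracket {n : ℕ} (Ω : Set (Fin n → ℝ)) (f : (Fin n → ℝ) → ℂ) (ε : ℝ) : ℝ≥0∞ :=
  ⨆ (S : Finset (Fin n → ℝ)) (_ : IsAdmissible Ω ε S),
    ENNReal.ofReal (ε ^ (n - 1)) * ∑ a ∈ S, meanOsc f (cube a ε)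

/-- The norm of `B(ℝⁿ)`, with values in `[0,∞]`. -/
def normB {n : ℕ} (f : (Fin n → ℝ) → ℂ) : ℝ≥0∞ :=
  (⨆ a : Fin n → ℝ, ∫⁻ x in cube a 1, ‖f x‖ₑ ∂volume) +
    ⨆ ε ∈ Ioo (0 : ℝ) 1, bracket univ f ε

/-- The norm of `B(Q₀)`, with values in `[0,∞]`. -/
def normBQ {n : ℕ} (f : (Fin n → ℝ) → ℂ) : ℝ≥0∞ :=
  (∫⁻ x in unitCube n, ‖f x‖ₑ ∂volume) +
    ⨆ ε ∈ Ioo (0 : ℝ) 1, bracket (unitCube n) f ε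

/-- The space `B(ℝⁿ)`. -/
def spaceB (n : ℕ) : Set ((Fin n → ℝ) → ℂ) :=
  {f | LocallyIntegrable f volume ∧ normB f < ⊤}

/-- The space `B(Q₀)`: measurable functions on `ℝⁿ`, integrable on `Q₀`, with finite norm. -/
def spaceBQ (n : ℕ) : Set ((Fin n → ℝ) → ℂ) :=
  {f | AEStronglyMeasurable f volume ∧ IntegrableOn f (unitCube n) volume ∧ normBQ f < ⊤}

/-- `C_c^∞(Ω)`: smooth functions with compact support contained in `Ω` (extended by zero). -/
def testFunctions {n : ℕ} (Ω : Set (Fin n → ℝ)) : Set ((Fin n → ℝ) → ℂ) :=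
  {φ | ContDiff ℝ ∞ φ ∧ HasCompactSupport φ ∧ tsupport φ ⊆ Ω}

/-- `B_c(ℝⁿ)`: the closure of `C_c^∞(ℝⁿ)` in `B(ℝⁿ)`. -/
def spaceBc (n : ℕ) : Set ((Fin n → ℝ) → ℂ) :=
  {f | f ∈ spaceB n ∧
    ∀ δ : ℝ≥0∞, 0 < δ → ∃ φ ∈ testFunctions (univ : Set (Fin n → ℝ)), normB (f - φ) < δ}

/-- `B_c(Q₀)`: the closure of `C_c^∞(Q₀)` in `B(Q₀)`. -/
def spaceBcQ (n : ℕ) : Set ((Fin n → ℝ) → ℂ) :=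
  {f | f ∈ spaceBQ n ∧
    ∀ δ : ℝ≥0∞, 0 < δ → ∃ φ ∈ testFunctions (unitCube n), normBQ (f - φ) < δ}

/-- `B_0(ℝⁿ)`: the functions in `B(ℝⁿ)` with `limsup_{ε → 0} [f]_ε = 0`. -/
def spaceB0 (n : ℕ) : Set ((Fin n → ℝ) → ℂ) :=
  {f | f ∈ spaceB n ∧ limsup (fun ε : ℝ => bracket univ f ε) (𝓝[>] (0 : ℝ)) = 0}

/-- `B_0(Q₀)`: the functions in `B(Q₀)` with `limsup_{ε → 0} [f]_{ε,Q₀} = 0`. -/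
def spaceB0Q (n : ℕ) : Set ((Fin n → ℝ) → ℂ) :=
  {f | f ∈ spaceBQ n ∧ limsup (fun ε : ℝ => bracket (unitCube n) f ε) (𝓝[>] (0 : ℝ)) = 0}

/-- The superposition operator `T_g f = g ∘ f`. -/
def superposition (n : ℕ) (g : ℂ → ℂ) (f : (Fin n → ℝ) → ℂ) : (Fin n → ℝ) → ℂ :=
  g ∘ f

/-- A set of functions is bounded for the `[0,∞]`-valued norm `N`. -/
def IsBoundedFor {n : ℕ} (N : ((Fin n → ℝ) → ℂ) → ℝ≥0∞) (A : Set ((Fin n → ℝ) → ℂ)) : Prop :=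
  ∃ C : ℝ≥0, ∀ f ∈ A, N f ≤ C

end BBM

end

/-!
The argument rests on comparing mean oscillations cube by cube.

If `g` is uniformly continuous, then `|g z - g w| ≤ δ + C |z - w|` with `δ` as small as desired
(`exists_enorm_sub_le_add_mul`), so `M(g ∘ f, Q) ≤ 2 δ + 2 C M(f, Q)` for every cube
(`meanOsc_comp_le`). Since a collection of `ε`-cubes counts at most `ε ^ (1 - n)` members, this passes
to the brackets with the same constants (`bracket_le_add_mul`); it gives the inclusions for `B_0` and
the boundedness of `T_g`. The spaces `B_c` lie in `B_0`, because a test function is uniformly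
continuous.

If `g` is not uniformly continuous, pick `x k`, `y k` with `|x k - y k| < 2 ^ (-k)` and
`|g (x k) - g (y k)| ≥ d > 0`. One function `f`, a limit of test functions in `B(ℝⁿ)` and in `B(Q₀)`,
refutes all four inclusions: a sum of test functions with disjoint supports, the `k`-th one equal to
`x k` or `y k` on fixed proportions of `ε ^ (1 - n)` disjoint `ε`-cubes, for some `ε < 2 ^ (-k)`
(`exists_oscillating_block`). Two facts make this possible.
* A cutoff equal to `1` near a point can have arbitrarily small norm (`exists_cutoff`), so the
  possibly huge value `x k` costs nothing, and passing from `x k` to `y k` costs only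
  `3 |x k - y k|`. The cutoff is the mean of `N` bumps at consecutive dyadic scales. A bump of scale
  `t` has mean oscillation `O(min (r / t) (t / r))` over a cube of side `r`
  (`exists_meanOsc_scaledBump_le`), so the sum over all dyadic scales is bounded and the mean is
  `O(1 / N)`.
* The required cubes have total volume `ε` only, so they fit into any prescribed ball once `ε` is
  small (`exists_disjoint_cubes`).
-/

namespace BBM

variable {n : ℕ}

/-! ### Cubes and mean oscillations -/

lemma cube_eq_ball (a : Fin n → ℝ) {r : ℝ} (hr : 0 < r) : cube a r = Metric.ball a (r / 2) := by
  ext x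
  simp [cube, dist_pi_lt_iff (half_pos hr), Real.dist_eq]

lemma unitCube_eq_cube : unitCube n = cube (fun _ => 1 / 2) 1 := by
  ext x
  simp only [unitCube, cube, mem_ofPred_eq, abs_lt]
  exact forall_congr' fun i => ⟨fun h => ⟨by linarith [h.1], by linarith [h.2]⟩,
    fun h => ⟨by linarith [h.1], by linarith [h.2]⟩⟩

lemma volume_cube (a : Fin n → ℝ) {r : ℝ} (hr : 0 < r) :
    volume (cube a r) = ENNReal.ofReal (r ^ n) := by
  rw [cube_eq_ball a hr, Real.volume_pi_ball a (half_pos hr)]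
  simp [mul_div_cancel₀]

lemma volume_cube_ne_zero (a : Fin n → ℝ) {r : ℝ} (hr : 0 < r) : volume (cube a r) ≠ 0 := by
  rw [volume_cube a hr]
  simpa using pow_pos hr n

lemma volume_cube_ne_top (a : Fin n → ℝ) {r : ℝ} (hr : 0 < r) : volume (cube a r) ≠ ⊤ := by
  rw [volume_cube a hr]
  exact ENNReal.ofReal_ne_top

lemma measurableSet_cube (a : Fin n → ℝ) {r : ℝ} (hr : 0 < r) : MeasurableSet (cube a r) := by
  rw [cube_eq_ball a hr]
  exact Metric.isOpen_ball.measurableSet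

lemma isProbabilityMeasure_cond_cube (a : Fin n → ℝ) {r : ℝ} (hr : 0 < r) :
    IsProbabilityMeasure (ProbabilityTheory.cond volume (cube a r)) :=
  ProbabilityTheory.cond_isProbabilityMeasure_of_finite (volume_cube_ne_zero a hr)
    (volume_cube_ne_top a hr)

lemma integrable_cond_cube {f : (Fin n → ℝ) → ℂ} {a : Fin n → ℝ} {r : ℝ} (hr : 0 < r)
    (hf : IntegrableOn f (cube a r)) : Integrable f (ProbabilityTheory.cond volume (cube a r)) :=
  hf.smul_measure (by simpa using volume_cube_ne_zero a hr)

/-- The mean oscillation as an `L¹` deviation from the mean under the uniform probability measure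
on `Q`. -/
lemma meanOsc_eq (f : (Fin n → ℝ) → ℂ) (Q : Set (Fin n → ℝ)) :
    meanOsc f Q = ∫⁻ x, ‖f x - ∫ y, f y ∂(ProbabilityTheory.cond volume Q)‖ₑ
      ∂(ProbabilityTheory.cond volume Q) := by
  simp only [meanOsc, laverage, average, Measure.restrict_apply_univ, ProbabilityTheory.cond]

/-- The mean is, up to a factor `2`, the best constant approximation in `L¹`. -/
lemma meanOsc_le_two_mul {f : (Fin n → ℝ) → ℂ} {a : Fin n → ℝ} {r : ℝ} (hr : 0 < r)
    (hf : IntegrableOn f (cube a r)) (c : ℂ) :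
    meanOsc f (cube a r) ≤
      2 * ∫⁻ x, ‖f x - c‖ₑ ∂(ProbabilityTheory.cond volume (cube a r)) := by
  have := isProbabilityMeasure_cond_cube a hr
  have hint := integrable_cond_cube hr hf
  rw [meanOsc_eq]
  set ν := ProbabilityTheory.cond volume (cube a r)
  have hc : ‖c - ∫ y, f y ∂ν‖ₑ ≤ ∫⁻ x, ‖f x - c‖ₑ ∂ν := by
    have h : ∫ y, (f y - c) ∂ν = (∫ y, f y ∂ν) - c := by
      rw [integral_sub hint (integrable_const c)]; simp
    rw [← neg_sub, enorm_neg, ← h]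
    exact enorm_integral_le_lintegral_enorm _
  calc ∫⁻ x, ‖f x - ∫ y, f y ∂ν‖ₑ ∂ν
      ≤ ∫⁻ x, (‖f x - c‖ₑ + ‖c - ∫ y, f y ∂ν‖ₑ) ∂ν := by
        refine lintegral_mono fun x => ?_
        rw [← sub_add_sub_cancel (f x) c]
        exact enorm_add_le _ _
    _ = (∫⁻ x, ‖f x - c‖ₑ ∂ν) + ‖c - ∫ y, f y ∂ν‖ₑ := by
        rw [lintegral_add_right _ measurable_const]; simp
    _ ≤ 2 * ∫⁻ x, ‖f x - c‖ₑ ∂ν := by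
        rw [two_mul]; gcongr

lemma meanOsc_const_mul (c : ℂ) (f : (Fin n → ℝ) → ℂ) (Q : Set (Fin n → ℝ)) :
    meanOsc (fun x => c * f x) Q = ‖c‖ₑ * meanOsc f Q := by
  simp only [meanOsc_eq, integral_const_mul, ← mul_sub, enorm_mul]
  exact lintegral_const_mul' _ _ enorm_ne_top

lemma meanOsc_add_le {f h : (Fin n → ℝ) → ℂ} {a : Fin n → ℝ} {r : ℝ} (hr : 0 < r)
    (hf : IntegrableOn f (cube a r)) (hh : IntegrableOn h (cube a r)) :
    meanOsc (f + h) (cube a r) ≤ meanOsc f (cube a r) + meanOsc h (cube a r) := by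
  have := isProbabilityMeasure_cond_cube a hr
  have hf' := integrable_cond_cube hr hf
  have hh' := integrable_cond_cube hr hh
  simp only [meanOsc_eq, Pi.add_apply]
  have hm : AEMeasurable (fun x => ‖f x - ∫ y, f y ∂(ProbabilityTheory.cond volume (cube a r))‖ₑ)
      (ProbabilityTheory.cond volume (cube a r)) :=
    (hf'.1.sub aestronglyMeasurable_const).enorm
  rw [integral_add hf' hh', ← lintegral_add_left' hm]
  refine lintegral_mono fun x => ?_
  simp only [add_sub_add_comm]
  exact enorm_add_le _ _

lemma meanOsc_zero (Q : Set (Fin n → ℝ)) : meanOsc (0 : (Fin n → ℝ) → ℂ) Q = 0 := by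
  simp [meanOsc_eq]

lemma meanOsc_sum_le {ι : Type*} (s : Finset ι) {f : ι → (Fin n → ℝ) → ℂ} {a : Fin n → ℝ}
    {r : ℝ} (hr : 0 < r) (hf : ∀ i ∈ s, IntegrableOn (f i) (cube a r)) :
    meanOsc (∑ i ∈ s, f i) (cube a r) ≤ ∑ i ∈ s, meanOsc (f i) (cube a r) := by
  classical
  induction s using Finset.induction_on with
  | empty => simp [meanOsc_zero]
  | insert i s hi ih =>
    rw [Finset.sum_insert hi, Finset.sum_insert hi]
    have hs : ∀ j ∈ s, IntegrableOn (f j) (cube a r) := fun j hj =>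
      hf j (Finset.mem_insert_of_mem hj)
    refine (meanOsc_add_le hr (hf i (Finset.mem_insert_self i s)) ?_).trans
      (by gcongr; exact ih hs)
    exact integrable_finsetSum' s hs

lemma meanOsc_tsum_le {f : ℕ → (Fin n → ℝ) → ℂ} {a : Fin n → ℝ} {r : ℝ} (hr : 0 < r)
    (hf : ∀ i, IntegrableOn (f i) (cube a r)) (hs : ∀ x, Summable fun i => f i x)
    (hfin : ∑' i, ∫⁻ x in cube a r, ‖f i x‖ₑ ≠ ⊤) :
    meanOsc (fun x => ∑' i, f i x) (cube a r) ≤ ∑' i, meanOsc (f i) (cube a r) := by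
  have := isProbabilityMeasure_cond_cube a hr
  have hf' := fun i => integrable_cond_cube hr (hf i)
  simp only [meanOsc_eq]
  set ν := ProbabilityTheory.cond volume (cube a r) with hν
  have hfin' : ∑' i, ∫⁻ x, ‖f i x‖ₑ ∂ν ≠ ⊤ := by
    simp only [hν, ProbabilityTheory.cond, lintegral_smul_measure, smul_eq_mul,
      ENNReal.tsum_mul_left]
    exact ENNReal.mul_ne_top (by simpa using volume_cube_ne_zero a hr) hfin
  have hm : ∀ i, AEMeasurable (fun x => ‖f i x - ∫ y, f i y ∂ν‖ₑ) ν := fun i =>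
    ((hf' i).1.sub aestronglyMeasurable_const).enorm
  rw [integral_tsum (fun i => (hf' i).1) hfin', ← lintegral_tsum hm]
  have hsI : Summable fun i => ∫ y, f i y ∂ν := by
    have h1 : ∑' i, ‖∫ y, f i y ∂ν‖ₑ ≠ ⊤ :=
      ne_top_of_le_ne_top hfin' (ENNReal.tsum_le_tsum fun i => enorm_integral_le_lintegral_enorm _)
    exact Summable.of_nnnorm (ENNReal.tsum_coe_ne_top_iff_summable.1 h1)
  refine lintegral_mono fun x => ?_
  simp only
  rw [← (hs x).tsum_sub hsI]
  exact enorm_tsum_le_tsum_enorm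

/-- A two-valued lower bound, with no integrability required: if `f` is `α` on one part of the cube
and `β` on another, each carrying at least the fraction `t` of the volume, then whatever the mean
is, it is far from `α` or from `β`. -/
lemma le_meanOsc_of_eqOn {f : (Fin n → ℝ) → ℂ} {Q A B : Set (Fin n → ℝ)} {α β : ℂ} {t : ℝ≥0∞}
    (hA : MeasurableSet A) (hB : MeasurableSet B) (hAB : Disjoint A B)
    (hfA : ∀ x ∈ A, f x = α) (hfB : ∀ x ∈ B, f x = β)
    (htA : t ≤ ProbabilityTheory.cond volume Q A) (htB : t ≤ ProbabilityTheory.cond volume Q B) :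
    ‖α - β‖ₑ * t ≤ meanOsc f Q := by
  rw [meanOsc_eq]
  set ν := ProbabilityTheory.cond volume Q
  set m := ∫ y, f y ∂ν
  calc ‖α - β‖ₑ * t ≤ (‖α - m‖ₑ + ‖β - m‖ₑ) * t := by
        gcongr
        rw [← sub_sub_sub_cancel_right α β m]
        exact enorm_sub_le
    _ ≤ ‖α - m‖ₑ * ν A + ‖β - m‖ₑ * ν B := by rw [add_mul]; gcongr
    _ = (∫⁻ x in A, ‖f x - m‖ₑ ∂ν) + ∫⁻ x in B, ‖f x - m‖ₑ ∂ν := by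
        rw [setLIntegral_congr_fun hA (g := fun _ => ‖α - m‖ₑ) fun x hx => by simp [hfA x hx],
          setLIntegral_congr_fun hB (g := fun _ => ‖β - m‖ₑ) fun x hx => by simp [hfB x hx]]
        simp
    _ = ∫⁻ x in A ∪ B, ‖f x - m‖ₑ ∂ν := (lintegral_union hB hAB).symm
    _ ≤ ∫⁻ x, ‖f x - m‖ₑ ∂ν := setLIntegral_le_lintegral _ _

/-! ### The bracket and the norms -/

lemma IsAdmissible.ofReal_mul_card_le {Ω : Set (Fin n → ℝ)} {ε : ℝ} {S : Finset (Fin n → ℝ)}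
    (hS : IsAdmissible Ω ε S) (hε : 0 < ε) :
    ENNReal.ofReal (ε ^ (n - 1)) * (S.card : ℝ≥0∞) ≤ 1 := by
  have h := hS.2.2
  rw [le_div_iff₀ (pow_pos hε _)] at h
  rw [← ENNReal.ofReal_natCast, ← ENNReal.ofReal_mul (pow_pos hε _).le]
  exact ENNReal.ofReal_le_one.2 (by linarith)

/-- An affine bound between mean oscillations passes to the brackets; the additive constant
survives because `ε ^ (n - 1) * #𝓕 ≤ 1`. -/
lemma bracket_le_add_mul {Ω : Set (Fin n → ℝ)} {f h : (Fin n → ℝ) → ℂ} {ε : ℝ} (hε : 0 < ε)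
    {A C : ℝ≥0∞} (H : ∀ a, cube a ε ⊆ Ω →
      meanOsc h (cube a ε) ≤ A + C * meanOsc f (cube a ε)) :
    bracket Ω h ε ≤ A + C * bracket Ω f ε := by
  refine iSup₂_le fun S hS => ?_
  calc ENNReal.ofReal (ε ^ (n - 1)) * ∑ a ∈ S, meanOsc h (cube a ε)
      ≤ ENNReal.ofReal (ε ^ (n - 1)) * ∑ a ∈ S, (A + C * meanOsc f (cube a ε)) := by
        gcongr with a ha; exact H a (hS.1 a ha)
    _ = (ENNReal.ofReal (ε ^ (n - 1)) * S.card) * A +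
          C * (ENNReal.ofReal (ε ^ (n - 1)) * ∑ a ∈ S, meanOsc f (cube a ε)) := by
        rw [Finset.sum_add_distrib, ← Finset.mul_sum, Finset.sum_const, nsmul_eq_mul]; ring
    _ ≤ 1 * A + C * bracket Ω f ε := by
        gcongr
        · exact hS.ofReal_mul_card_le hε
        · exact le_iSup₂ (f := fun (S : Finset (Fin n → ℝ)) (_ : IsAdmissible Ω ε S) =>
            ENNReal.ofReal (ε ^ (n - 1)) * ∑ a ∈ S, meanOsc f (cube a ε)) S hS
    _ = _ := by rw [one_mul]

lemma bracket_le {Ω : Set (Fin n → ℝ)} {f : (Fin n → ℝ) → ℂ} {ε : ℝ} (hε : 0 < ε)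
    {A : ℝ≥0∞} (H : ∀ a, cube a ε ⊆ Ω → meanOsc f (cube a ε) ≤ A) :
    bracket Ω f ε ≤ A := by
  simpa using bracket_le_add_mul (f := f) (C := 0) hε fun a ha => by simpa using H a ha

lemma bracket_add_le {Ω : Set (Fin n → ℝ)} {f h : (Fin n → ℝ) → ℂ} {ε : ℝ} (hε : 0 < ε)
    (hf : ∀ a, cube a ε ⊆ Ω → IntegrableOn f (cube a ε))
    (hh : ∀ a, cube a ε ⊆ Ω → IntegrableOn h (cube a ε)) :
    bracket Ω (f + h) ε ≤ bracket Ω f ε + bracket Ω h ε := by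
  refine iSup₂_le fun S hS => ?_
  calc ENNReal.ofReal (ε ^ (n - 1)) * ∑ a ∈ S, meanOsc (f + h) (cube a ε)
      ≤ ENNReal.ofReal (ε ^ (n - 1)) *
          ∑ a ∈ S, (meanOsc f (cube a ε) + meanOsc h (cube a ε)) := by
        gcongr with a ha
        exact meanOsc_add_le hε (hf a (hS.1 a ha)) (hh a (hS.1 a ha))
    _ ≤ _ := by
        rw [Finset.sum_add_distrib, mul_add]
        exact add_le_add
          (le_iSup₂ (f := fun (S : Finset (Fin n → ℝ)) (_ : IsAdmissible Ω ε S) =>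
            ENNReal.ofReal (ε ^ (n - 1)) * ∑ a ∈ S, meanOsc f (cube a ε)) S hS)
          (le_iSup₂ (f := fun (S : Finset (Fin n → ℝ)) (_ : IsAdmissible Ω ε S) =>
            ENNReal.ofReal (ε ^ (n - 1)) * ∑ a ∈ S, meanOsc h (cube a ε)) S hS)

lemma bracket_mono {Ω Ω' : Set (Fin n → ℝ)} (h : Ω ⊆ Ω') (f : (Fin n → ℝ) → ℂ) (ε : ℝ) :
    bracket Ω f ε ≤ bracket Ω' f ε :=
  iSup₂_le fun S hS => le_iSup₂ (f := fun (S : Finset (Fin n → ℝ)) (_ : IsAdmissible Ω' ε S) =>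
    ENNReal.ofReal (ε ^ (n - 1)) * ∑ a ∈ S, meanOsc f (cube a ε)) S
    ⟨fun a ha => (hS.1 a ha).trans h, hS.2⟩

lemma normBQ_le_normB (f : (Fin n → ℝ) → ℂ) : normBQ f ≤ normB f := by
  refine add_le_add ?_ (iSup₂_mono fun ε _ => bracket_mono (subset_univ _) f ε)
  rw [unitCube_eq_cube]
  exact le_iSup (fun a : Fin n → ℝ => ∫⁻ x in cube a 1, ‖f x‖ₑ) _

lemma lintegral_cube_le_normB (f : (Fin n → ℝ) → ℂ) (a : Fin n → ℝ) :
    ∫⁻ x in cube a 1, ‖f x‖ₑ ≤ normB f :=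
  (le_iSup (fun a : Fin n → ℝ => ∫⁻ x in cube a 1, ‖f x‖ₑ) a).trans le_self_add

lemma bracket_le_normB (f : (Fin n → ℝ) → ℂ) {ε : ℝ} (hε : ε ∈ Ioo (0 : ℝ) 1) :
    bracket univ f ε ≤ normB f :=
  (le_iSup₂ (f := fun ε (_ : ε ∈ Ioo (0 : ℝ) 1) => bracket univ f ε) ε hε).trans le_add_self

lemma bracket_le_normBQ (f : (Fin n → ℝ) → ℂ) {ε : ℝ} (hε : ε ∈ Ioo (0 : ℝ) 1) :
    bracket (unitCube n) f ε ≤ normBQ f :=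
  (le_iSup₂ (f := fun ε (_ : ε ∈ Ioo (0 : ℝ) 1) => bracket (unitCube n) f ε) ε hε).trans
    le_add_self

lemma normB_le {f : (Fin n → ℝ) → ℂ} {A B : ℝ≥0∞} (hA : ∀ a, ∫⁻ x in cube a 1, ‖f x‖ₑ ≤ A)
    (hB : ∀ ε ∈ Ioo (0 : ℝ) 1, bracket univ f ε ≤ B) : normB f ≤ A + B :=
  add_le_add (iSup_le hA) (iSup₂_le hB)

lemma normBQ_le {f : (Fin n → ℝ) → ℂ} {A B : ℝ≥0∞} (hA : ∫⁻ x in unitCube n, ‖f x‖ₑ ≤ A)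
    (hB : ∀ ε ∈ Ioo (0 : ℝ) 1, bracket (unitCube n) f ε ≤ B) : normBQ f ≤ A + B :=
  add_le_add hA (iSup₂_le hB)

lemma integrableOn_cube {f : (Fin n → ℝ) → ℂ} (hf : LocallyIntegrable f) (a : Fin n → ℝ) {r : ℝ}
    (hr : 0 < r) : IntegrableOn f (cube a r) := by
  rw [cube_eq_ball a hr]
  exact (hf.integrableOn_isCompact (isCompact_closedBall a (r / 2))).mono_set
    Metric.ball_subset_closedBall

/-- In `[0, ∞]` a vanishing upper limit is convergence to zero. -/
lemma limsup_eq_zero_iff_eventually_le {α : Type*} {l : Filter α} {u : α → ℝ≥0∞} :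
    limsup u l = 0 ↔ ∀ δ : ℝ≥0, 0 < δ → ∀ᶠ x in l, u x ≤ δ := by
  constructor
  · intro h δ hδ
    have h' : limsup u l < (δ : ℝ≥0∞) := by rw [h]; exact_mod_cast hδ
    exact (eventually_lt_of_limsup_lt h').mono fun _ hx => hx.le
  · intro h
    refine le_antisymm (ENNReal.le_of_forall_pos_le_add fun δ hδ _ => ?_) zero_le
    rw [zero_add]
    exact limsup_le_of_le (by isBoundedDefault) (h δ hδ)

lemma eventually_mem_Ioo : ∀ᶠ ε : ℝ in 𝓝[>] (0 : ℝ), ε ∈ Ioo (0 : ℝ) 1 :=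
  Ioo_mem_nhdsGT one_pos

/-! ### Composition with a uniformly continuous function -/

/-- A uniformly continuous function is Lipschitz up to an arbitrarily small additive error: join
two points by a chain of steps shorter than the modulus of continuity. -/
lemma exists_enorm_sub_le_add_mul {g : ℂ → ℂ} (hg : UniformContinuous g) {δ : ℝ≥0} (hδ : 0 < δ) :
    ∃ C : ℝ≥0, ∀ x y, ‖g x - g y‖ₑ ≤ δ + C * ‖x - y‖ₑ := by
  obtain ⟨η, hη, H⟩ := Metric.uniformContinuous_iff.1 hg δ hδ
  refine ⟨δ / η.toNNReal, fun x y => ?_⟩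
  set m : ℕ := ⌊‖x - y‖ / η⌋₊ + 1 with hm
  have hm0 : (0 : ℝ) < m := by positivity
  have hlt : ‖x - y‖ / m < η := by
    rw [div_lt_iff₀ hm0, mul_comm, ← div_lt_iff₀ hη, hm]
    exact_mod_cast Nat.lt_floor_add_one _
  let p : ℕ → ℂ := fun k => y + (k / m : ℝ) * (x - y)
  have hp : ∀ {k}, k < m → dist (g (p k)) (g (p (k + 1))) ≤ δ := fun {k} _ => by
    refine (H ?_).le
    have : p k - p (k + 1) = -((1 / m : ℝ) * (x - y)) := by
      simp only [p]; push_cast; ring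
    rw [dist_eq_norm, this, norm_neg, norm_mul, Complex.norm_real,
      Real.norm_of_nonneg (by positivity)]
    rwa [one_div_mul_eq_div]
  have hsum := dist_le_range_sum_of_dist_le (f := fun k => g (p k)) m hp
  have h0 : p 0 = y := by simp [p]
  have h1 : p m = x := by simp [p]
  rw [h0, h1, dist_comm, dist_eq_norm, Finset.sum_const, Finset.card_range, nsmul_eq_mul] at hsum
  have hfl : (m : ℝ) ≤ 1 + ‖x - y‖ / η := by
    have := Nat.floor_le (div_nonneg (norm_nonneg (x - y)) hη.le)
    rw [hm]; push_cast; linarith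
  have key : ‖g x - g y‖ ≤ δ + δ / η * ‖x - y‖ := by
    calc ‖g x - g y‖ ≤ m * δ := hsum
      _ ≤ (1 + ‖x - y‖ / η) * δ := by gcongr
      _ = _ := by ring
  have key' : ‖g x - g y‖₊ ≤ δ + δ / η.toNNReal * ‖x - y‖₊ := by
    rw [← NNReal.coe_le_coe]
    push_cast
    rwa [Real.coe_toNNReal η hη.le]
  simp only [enorm_eq_nnnorm]
  exact_mod_cast key'

/-- `C` plays the role of a Lipschitz constant of `g` up to the error `δ`. -/
lemma meanOsc_comp_le {g : ℂ → ℂ} {δ C : ℝ≥0} (hC : ∀ x y, ‖g x - g y‖ₑ ≤ δ + C * ‖x - y‖ₑ)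
    {f : (Fin n → ℝ) → ℂ} {a : Fin n → ℝ} {r : ℝ} (hr : 0 < r)
    (hgf : IntegrableOn (g ∘ f) (cube a r)) :
    meanOsc (g ∘ f) (cube a r) ≤ 2 * δ + 2 * C * meanOsc f (cube a r) := by
  have := isProbabilityMeasure_cond_cube a hr
  rw [meanOsc_eq f]
  set ν := ProbabilityTheory.cond volume (cube a r) with hν
  refine (meanOsc_le_two_mul hr hgf (g (∫ y, f y ∂ν))).trans ?_
  rw [← hν]
  calc 2 * ∫⁻ x, ‖(g ∘ f) x - g (∫ y, f y ∂ν)‖ₑ ∂ν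
      ≤ 2 * ∫⁻ x, (δ + C * ‖f x - ∫ y, f y ∂ν‖ₑ) ∂ν := by
        gcongr with x; exact hC _ _
    _ = 2 * δ + 2 * C * ∫⁻ x, ‖f x - ∫ y, f y ∂ν‖ₑ ∂ν := by
        rw [lintegral_add_left measurable_const, lintegral_const_mul' _ _ ENNReal.coe_ne_top]
        simp [mul_add, mul_assoc]

lemma enorm_comp_le {g : ℂ → ℂ} {δ C : ℝ≥0} (hC : ∀ x y, ‖g x - g y‖ₑ ≤ δ + C * ‖x - y‖ₑ)
    (z : ℂ) : ‖g z‖ₑ ≤ ‖g 0‖ₑ + δ + C * ‖z‖ₑ := by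
  calc ‖g z‖ₑ = ‖g 0 + (g z - g 0)‖ₑ := by rw [add_sub_cancel]
    _ ≤ ‖g 0‖ₑ + ‖g z - g 0‖ₑ := enorm_add_le _ _
    _ ≤ ‖g 0‖ₑ + (δ + C * ‖z - 0‖ₑ) := by gcongr; exact hC z 0
    _ = _ := by rw [sub_zero, add_assoc]

lemma integrableOn_comp {g : ℂ → ℂ} (hg : Continuous g) {δ C : ℝ≥0}
    (hC : ∀ x y, ‖g x - g y‖ₑ ≤ δ + C * ‖x - y‖ₑ) {f : (Fin n → ℝ) → ℂ} {s : Set (Fin n → ℝ)}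
    (hs : volume s ≠ ⊤) (hf : IntegrableOn f s) : IntegrableOn (g ∘ f) s := by
  refine ⟨hg.comp_aestronglyMeasurable hf.1, ?_⟩
  calc ∫⁻ x in s, ‖(g ∘ f) x‖ₑ
      ≤ ∫⁻ x in s, (‖g 0‖ₑ + δ + C * ‖f x‖ₑ) := lintegral_mono fun x => enorm_comp_le hC _
    _ = (‖g 0‖ₑ + δ) * volume s + C * ∫⁻ x in s, ‖f x‖ₑ := by
        rw [lintegral_add_left measurable_const, lintegral_const_mul' _ _ ENNReal.coe_ne_top]
        simp
    _ < ⊤ := by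
        have h2 : ∫⁻ x in s, ‖f x‖ₑ < ⊤ := hf.2
        exact ENNReal.add_lt_top.2 ⟨ENNReal.mul_lt_top (by simp) hs.lt_top,
          ENNReal.mul_lt_top (by simp) h2⟩

lemma lintegral_comp_le {g : ℂ → ℂ} {δ C : ℝ≥0} (hC : ∀ x y, ‖g x - g y‖ₑ ≤ δ + C * ‖x - y‖ₑ)
    (f : (Fin n → ℝ) → ℂ) (a : Fin n → ℝ) :
    ∫⁻ x in cube a 1, ‖(g ∘ f) x‖ₑ ≤ ‖g 0‖ₑ + δ + C * ∫⁻ x in cube a 1, ‖f x‖ₑ := by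
  refine (lintegral_mono fun x => enorm_comp_le hC (f x)).trans ?_
  rw [lintegral_add_left measurable_const, lintegral_const_mul' _ _ ENNReal.coe_ne_top]
  simp [volume_cube a one_pos]

lemma locallyIntegrable_comp {g : ℂ → ℂ} (hg : UniformContinuous g) {f : (Fin n → ℝ) → ℂ}
    (hf : LocallyIntegrable f) : LocallyIntegrable (g ∘ f) := by
  obtain ⟨C, hC⟩ := exists_enorm_sub_le_add_mul hg one_pos
  refine locallyIntegrable_iff.2 fun K hK => ?_
  exact integrableOn_comp hg.continuous hC hK.measure_ne_top (hf.integrableOn_isCompact hK)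

lemma bracket_comp_le {g : ℂ → ℂ} {δ C : ℝ≥0} (hC : ∀ x y, ‖g x - g y‖ₑ ≤ δ + C * ‖x - y‖ₑ)
    {Ω : Set (Fin n → ℝ)} {f : (Fin n → ℝ) → ℂ} {ε : ℝ} (hε : 0 < ε)
    (hgf : ∀ a, cube a ε ⊆ Ω → IntegrableOn (g ∘ f) (cube a ε)) :
    bracket Ω (g ∘ f) ε ≤ 2 * δ + 2 * C * bracket Ω f ε :=
  bracket_le_add_mul hε fun a ha => meanOsc_comp_le hC hε (hgf a ha)

lemma limsup_bracket_comp_eq_zero {g : ℂ → ℂ} (hg : UniformContinuous g) {Ω : Set (Fin n → ℝ)}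
    {f : (Fin n → ℝ) → ℂ}
    (hgf : ∀ ε : ℝ, 0 < ε → ∀ a, cube a ε ⊆ Ω → IntegrableOn (g ∘ f) (cube a ε))
    (hf : limsup (fun ε : ℝ => bracket Ω f ε) (𝓝[>] (0 : ℝ)) = 0) :
    limsup (fun ε : ℝ => bracket Ω (g ∘ f) ε) (𝓝[>] (0 : ℝ)) = 0 := by
  rw [limsup_eq_zero_iff_eventually_le] at hf ⊢
  intro δ hδ
  obtain ⟨C, hC⟩ := exists_enorm_sub_le_add_mul hg (δ := δ / 4) (by positivity)
  filter_upwards [eventually_mem_Ioo, hf (δ / (4 * (C + 1))) (by positivity)] with ε hε hfε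
  refine (bracket_comp_le hC hε.1 (hgf ε hε.1)).trans ?_
  calc 2 * ((δ / 4 : ℝ≥0) : ℝ≥0∞) + 2 * C * bracket Ω f ε
      ≤ 2 * ((δ / 4 : ℝ≥0) : ℝ≥0∞) + 2 * C * ((δ / (4 * (C + 1)) : ℝ≥0) : ℝ≥0∞) := by gcongr
    _ ≤ δ := by
        have : 2 * (δ / 4) + 2 * C * (δ / (4 * (C + 1))) ≤ δ := by
          rw [← NNReal.coe_le_coe]
          push_cast
          have hC0 : (0 : ℝ) < (C : ℝ) + 1 := by positivity
          have : 2 * (C : ℝ) * (δ / (4 * (C + 1))) ≤ δ / 2 := by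
            rw [← mul_div_assoc, div_le_div_iff₀ (by positivity) two_pos]
            nlinarith [δ.coe_nonneg, C.coe_nonneg]
          linarith
        exact_mod_cast this

lemma normB_comp_le {g : ℂ → ℂ} (hg : Continuous g) {δ C : ℝ≥0}
    (hC : ∀ x y, ‖g x - g y‖ₑ ≤ δ + C * ‖x - y‖ₑ) {f : (Fin n → ℝ) → ℂ}
    (hf : LocallyIntegrable f) :
    normB (g ∘ f) ≤ (‖g 0‖ₑ + δ + C * normB f) + (2 * δ + 2 * C * normB f) := by
  refine normB_le (fun a => (lintegral_comp_le hC f a).trans ?_) fun ε hε =>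
    (bracket_comp_le hC hε.1 fun a _ => ?_).trans ?_
  · gcongr; exact lintegral_cube_le_normB f a
  · exact integrableOn_comp hg hC (volume_cube_ne_top a hε.1) (integrableOn_cube hf a hε.1)
  · gcongr; exact bracket_le_normB f hε

lemma normBQ_comp_le {g : ℂ → ℂ} (hg : Continuous g) {δ C : ℝ≥0}
    (hC : ∀ x y, ‖g x - g y‖ₑ ≤ δ + C * ‖x - y‖ₑ) {f : (Fin n → ℝ) → ℂ}
    (hf : IntegrableOn f (unitCube n)) :
    normBQ (g ∘ f) ≤ (‖g 0‖ₑ + δ + C * normBQ f) + (2 * δ + 2 * C * normBQ f) := by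
  refine normBQ_le ?_ fun ε hε => (bracket_comp_le hC hε.1 fun a ha => ?_).trans ?_
  · rw [unitCube_eq_cube]
    refine (lintegral_comp_le hC f _).trans ?_
    rw [← unitCube_eq_cube]
    gcongr
    exact le_self_add
  · exact integrableOn_comp hg hC (volume_cube_ne_top a hε.1) (hf.mono_set ha)
  · gcongr; exact bracket_le_normBQ f hε

lemma comp_mem_spaceB0 {g : ℂ → ℂ} (hg : UniformContinuous g) {f : (Fin n → ℝ) → ℂ}
    (hf : f ∈ spaceB0 n) : g ∘ f ∈ spaceB0 n := by
  obtain ⟨C, hC⟩ := exists_enorm_sub_le_add_mul hg one_pos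
  obtain ⟨⟨hloc, hfin⟩, hlim⟩ := hf
  have hloc' := locallyIntegrable_comp hg hloc
  refine ⟨⟨hloc', (normB_comp_le hg.continuous hC hloc).trans_lt ?_⟩,
    limsup_bracket_comp_eq_zero hg (fun ε hε a _ => integrableOn_cube hloc' a hε) hlim⟩
  simp [ENNReal.add_lt_top, ENNReal.mul_lt_top, hfin]

lemma comp_mem_spaceB0Q {g : ℂ → ℂ} (hg : UniformContinuous g) {f : (Fin n → ℝ) → ℂ}
    (hf : f ∈ spaceB0Q n) : g ∘ f ∈ spaceB0Q n := by
  obtain ⟨C, hC⟩ := exists_enorm_sub_le_add_mul hg one_pos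
  obtain ⟨⟨hmeas, hint, hfin⟩, hlim⟩ := hf
  have hvol : volume (unitCube n) ≠ ⊤ := by
    rw [unitCube_eq_cube]; exact volume_cube_ne_top _ one_pos
  have hint' := integrableOn_comp hg.continuous hC hvol hint
  refine ⟨⟨hg.continuous.comp_aestronglyMeasurable hmeas, hint',
    (normBQ_comp_le hg.continuous hC hint).trans_lt ?_⟩,
    limsup_bracket_comp_eq_zero hg (fun ε _ a ha => hint'.mono_set ha) hlim⟩
  simp [ENNReal.add_lt_top, ENNReal.mul_lt_top, hfin]

lemma isBoundedFor_normB_image {g : ℂ → ℂ} (hg : UniformContinuous g)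
    {A : Set ((Fin n → ℝ) → ℂ)} (hA : A ⊆ spaceB0 n) (hb : IsBoundedFor normB A) :
    IsBoundedFor normB (superposition n g '' A) := by
  obtain ⟨C, hC⟩ := exists_enorm_sub_le_add_mul hg one_pos
  obtain ⟨K, hK⟩ := hb
  refine ⟨(‖g 0‖₊ + 1 + C * K) + (2 * 1 + 2 * C * K), ?_⟩
  rintro _ ⟨f, hf, rfl⟩
  refine (normB_comp_le hg.continuous hC (hA hf).1.1).trans ?_
  push_cast
  gcongr <;> first | exact hK f hf | rfl

lemma isBoundedFor_normBQ_image {g : ℂ → ℂ} (hg : UniformContinuous g)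
    {A : Set ((Fin n → ℝ) → ℂ)} (hA : A ⊆ spaceB0Q n) (hb : IsBoundedFor normBQ A) :
    IsBoundedFor normBQ (superposition n g '' A) := by
  obtain ⟨C, hC⟩ := exists_enorm_sub_le_add_mul hg one_pos
  obtain ⟨K, hK⟩ := hb
  refine ⟨(‖g 0‖₊ + 1 + C * K) + (2 * 1 + 2 * C * K), ?_⟩
  rintro _ ⟨f, hf, rfl⟩
  refine (normBQ_comp_le hg.continuous hC (hA hf).1.2.1).trans ?_
  push_cast
  gcongr <;> first | exact hK f hf | rfl

/-! ### Limits of test functions have vanishing brackets -/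

lemma integrable_of_mem_testFunctions {Ω : Set (Fin n → ℝ)} {φ : (Fin n → ℝ) → ℂ}
    (hφ : φ ∈ testFunctions Ω) : Integrable φ :=
  hφ.1.continuous.integrable_of_hasCompactSupport hφ.2.1

/-- If `f` stays within `A` of a constant on the cube, its mean oscillation there is at most
`2 * A`. -/
lemma meanOsc_le_of_forall_enorm_sub_le {f : (Fin n → ℝ) → ℂ} {a : Fin n → ℝ} {r : ℝ} (hr : 0 < r)
    (hf : IntegrableOn f (cube a r)) {c : ℂ} {A : ℝ≥0∞}
    (h : ∀ x ∈ cube a r, ‖f x - c‖ₑ ≤ A) : meanOsc f (cube a r) ≤ 2 * A := by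
  have := isProbabilityMeasure_cond_cube a hr
  refine (meanOsc_le_two_mul hr hf c).trans ?_
  gcongr
  calc ∫⁻ x, ‖f x - c‖ₑ ∂(ProbabilityTheory.cond volume (cube a r))
      ≤ ∫⁻ _, A ∂(ProbabilityTheory.cond volume (cube a r)) :=
        lintegral_mono_ae (ProbabilityTheory.ae_cond_of_forall_mem (measurableSet_cube a hr) h)
    _ = A := by simp

lemma eventually_bracket_le_of_mem_testFunctions {Ω : Set (Fin n → ℝ)} (Ω' : Set (Fin n → ℝ))
    {φ : (Fin n → ℝ) → ℂ} (hφ : φ ∈ testFunctions Ω) {δ : ℝ≥0} (hδ : 0 < δ) :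
    ∀ᶠ ε : ℝ in 𝓝[>] (0 : ℝ), bracket Ω' φ ε ≤ δ := by
  have huc : UniformContinuous φ := hφ.2.1.uniformContinuous_of_continuous hφ.1.continuous
  obtain ⟨η, hη, H⟩ := Metric.uniformContinuous_iff.1 huc (δ / 2) (by positivity)
  filter_upwards [Ioo_mem_nhdsGT hη] with ε hε
  refine bracket_le hε.1 fun a _ => ?_
  refine (meanOsc_le_of_forall_enorm_sub_le (c := φ a) (A := (δ / 2 : ℝ≥0)) hε.1
    (integrable_of_mem_testFunctions hφ).integrableOn fun x hx => ?_).trans_eq ?_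
  · rw [cube_eq_ball a hε.1, Metric.mem_ball] at hx
    have := H (hx.trans (by linarith [hε.1, hε.2]))
    rw [dist_eq_norm] at this
    rw [enorm_eq_nnnorm]
    have h' : ‖φ x - φ a‖₊ ≤ δ / 2 := by
      rw [← NNReal.coe_le_coe]; push_cast; exact this.le
    exact_mod_cast h'
  · have : 2 * (δ / 2) = δ := mul_div_cancel₀ _ two_ne_zero
    exact_mod_cast this

lemma limsup_bracket_eq_zero_of_approx {Ω : Set (Fin n → ℝ)} {f : (Fin n → ℝ) → ℂ}
    (hf : ∀ ε : ℝ, 0 < ε → ∀ a, cube a ε ⊆ Ω → IntegrableOn f (cube a ε))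
    (happ : ∀ δ : ℝ≥0, 0 < δ → ∃ φ ∈ testFunctions Ω,
      ∀ ε ∈ Ioo (0 : ℝ) 1, bracket Ω (f - φ) ε ≤ δ) :
    limsup (fun ε : ℝ => bracket Ω f ε) (𝓝[>] (0 : ℝ)) = 0 := by
  rw [limsup_eq_zero_iff_eventually_le]
  intro δ hδ
  obtain ⟨φ, hφ, H⟩ := happ (δ / 2) (by positivity)
  filter_upwards [eventually_mem_Ioo,
    eventually_bracket_le_of_mem_testFunctions Ω hφ (δ := δ / 2) (by positivity)] with ε hε h2
  have hφi := integrable_of_mem_testFunctions hφ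
  calc bracket Ω f ε = bracket Ω ((f - φ) + φ) ε := by rw [sub_add_cancel]
    _ ≤ bracket Ω (f - φ) ε + bracket Ω φ ε :=
        bracket_add_le hε.1 (fun a ha => (hf ε hε.1 a ha).sub hφi.integrableOn)
          fun a _ => hφi.integrableOn
    _ ≤ (δ / 2 : ℝ≥0) + (δ / 2 : ℝ≥0) := add_le_add (H ε hε) h2
    _ = δ := by exact_mod_cast add_halves δ

lemma spaceBc_subset_spaceB0 : spaceBc n ⊆ spaceB0 n := by
  rintro f ⟨hf, happ⟩
  refine ⟨hf, limsup_bracket_eq_zero_of_approx (fun ε hε a _ => integrableOn_cube hf.1 a hε)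
    fun δ hδ => ?_⟩
  obtain ⟨φ, hφ, H⟩ := happ δ (by exact_mod_cast hδ)
  exact ⟨φ, hφ, fun ε hε => (bracket_le_normB _ hε).trans H.le⟩

lemma spaceBcQ_subset_spaceB0Q : spaceBcQ n ⊆ spaceB0Q n := by
  rintro f ⟨hf, happ⟩
  refine ⟨hf, limsup_bracket_eq_zero_of_approx (fun ε _ a ha => hf.2.1.mono_set ha)
    fun δ hδ => ?_⟩
  obtain ⟨φ, hφ, H⟩ := happ δ (by exact_mod_cast hδ)
  exact ⟨φ, hφ, fun ε hε => (bracket_le_normBQ _ hε).trans H.le⟩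

/-! ### Series in the norm of `B(ℝⁿ)` -/

lemma normB_const_mul (c : ℂ) (f : (Fin n → ℝ) → ℂ) :
    normB (fun x => c * f x) = ‖c‖ₑ * normB f := by
  simp only [normB, bracket, meanOsc_const_mul, enorm_mul, lintegral_const_mul' _ _ enorm_ne_top,
    ← Finset.mul_sum, mul_left_comm _ ‖c‖ₑ, ← ENNReal.mul_iSup, ← mul_add]

lemma normB_add_le {f h : (Fin n → ℝ) → ℂ} (hf : Integrable f) (hh : Integrable h) :
    normB (f + h) ≤ normB f + normB h := by
  have h1 : ∀ a, ∫⁻ x in cube a 1, ‖(f + h) x‖ₑ ≤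
      (⨆ a : Fin n → ℝ, ∫⁻ x in cube a 1, ‖f x‖ₑ) +
        ⨆ a : Fin n → ℝ, ∫⁻ x in cube a 1, ‖h x‖ₑ := fun a => by
    refine (lintegral_mono fun x => enorm_add_le (f x) (h x)).trans ?_
    rw [lintegral_add_left' hf.1.enorm.restrict]
    exact add_le_add (le_iSup (fun a : Fin n → ℝ => ∫⁻ x in cube a 1, ‖f x‖ₑ) a)
      (le_iSup (fun a : Fin n → ℝ => ∫⁻ x in cube a 1, ‖h x‖ₑ) a)
  have h2 : ∀ ε ∈ Ioo (0 : ℝ) 1, bracket univ (f + h) ε ≤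
      (⨆ ε ∈ Ioo (0 : ℝ) 1, bracket univ f ε) + ⨆ ε ∈ Ioo (0 : ℝ) 1, bracket univ h ε :=
    fun ε hε => (bracket_add_le hε.1 (fun a _ => hf.integrableOn)
      fun a _ => hh.integrableOn).trans (add_le_add
        (le_iSup₂ (f := fun ε (_ : ε ∈ Ioo (0 : ℝ) 1) => bracket univ f ε) ε hε)
        (le_iSup₂ (f := fun ε (_ : ε ∈ Ioo (0 : ℝ) 1) => bracket univ h ε) ε hε))
  exact (normB_le h1 h2).trans_eq (add_add_add_comm _ _ _ _)

lemma bracket_tsum_le {Ω : Set (Fin n → ℝ)} {f : ℕ → (Fin n → ℝ) → ℂ} {h : (Fin n → ℝ) → ℂ} {ε : ℝ}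
    (H : ∀ a, cube a ε ⊆ Ω → meanOsc h (cube a ε) ≤ ∑' i, meanOsc (f i) (cube a ε)) :
    bracket Ω h ε ≤ ∑' i, bracket Ω (f i) ε := by
  refine iSup₂_le fun S hS => ?_
  calc ENNReal.ofReal (ε ^ (n - 1)) * ∑ a ∈ S, meanOsc h (cube a ε)
      ≤ ENNReal.ofReal (ε ^ (n - 1)) * ∑ a ∈ S, ∑' i, meanOsc (f i) (cube a ε) := by
        gcongr with a ha; exact H a (hS.1 a ha)
    _ = ∑' i, ENNReal.ofReal (ε ^ (n - 1)) * ∑ a ∈ S, meanOsc (f i) (cube a ε) := by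
        rw [← Summable.tsum_finsetSum fun _ _ => ENNReal.summable, ENNReal.tsum_mul_left]
    _ ≤ ∑' i, bracket Ω (f i) ε := ENNReal.tsum_le_tsum fun i =>
        le_iSup₂ (f := fun (S : Finset (Fin n → ℝ)) (_ : IsAdmissible Ω ε S) =>
          ENNReal.ofReal (ε ^ (n - 1)) * ∑ a ∈ S, meanOsc (f i) (cube a ε)) S hS

lemma normB_tsum_le {f : ℕ → (Fin n → ℝ) → ℂ} (hf : ∀ i, Integrable (f i))
    (hs : ∀ x, Summable fun i => f i x) (hfin : ∑' i, normB (f i) ≠ ⊤) :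
    normB (fun x => ∑' i, f i x) ≤ ∑' i, normB (f i) := by
  have hcube : ∀ a, ∑' i, ∫⁻ x in cube a 1, ‖f i x‖ₑ ≤ ∑' i, normB (f i) := fun a =>
    ENNReal.tsum_le_tsum fun i => lintegral_cube_le_normB (f i) a
  have h1 : ∀ a, ∫⁻ x in cube a 1, ‖∑' i, f i x‖ₑ ≤
      ∑' i, ⨆ a : Fin n → ℝ, ∫⁻ x in cube a 1, ‖f i x‖ₑ := fun a => by
    refine (lintegral_mono fun x => enorm_tsum_le_tsum_enorm).trans ?_
    rw [lintegral_tsum fun i => (hf i).1.enorm.restrict]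
    exact ENNReal.tsum_le_tsum fun i =>
      le_iSup (fun a : Fin n → ℝ => ∫⁻ x in cube a 1, ‖f i x‖ₑ) a
  have h2 : ∀ ε ∈ Ioo (0 : ℝ) 1, bracket univ (fun x => ∑' i, f i x) ε ≤
      ∑' i, ⨆ ε ∈ Ioo (0 : ℝ) 1, bracket univ (f i) ε := fun ε hε => by
    refine (bracket_tsum_le (f := f) fun a _ => ?_).trans (ENNReal.tsum_le_tsum fun i =>
      le_iSup₂ (f := fun ε (_ : ε ∈ Ioo (0 : ℝ) 1) => bracket univ (f i) ε) ε hε)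
    refine meanOsc_tsum_le hε.1 (fun i => (hf i).integrableOn) hs
      (ne_top_of_le_ne_top (ne_top_of_le_ne_top hfin (hcube a)) ?_)
    refine ENNReal.tsum_le_tsum fun i => lintegral_mono_set ?_
    rw [cube_eq_ball a hε.1, cube_eq_ball a one_pos]
    exact Metric.ball_subset_ball (by linarith [hε.2])
  exact (normB_le h1 h2).trans_eq ENNReal.tsum_add.symm

/-- A function bounded by `1` has norm at most `3` in `B(ℝⁿ)`. -/
lemma normB_le_three {f : (Fin n → ℝ) → ℂ} (hf : Integrable f) (h : ∀ x, ‖f x‖ ≤ 1) :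
    normB f ≤ 3 := by
  have h' : ∀ x, ‖f x‖ₑ ≤ 1 := fun x => by
    rw [← ofReal_norm]; exact ENNReal.ofReal_le_one.2 (h x)
  refine (normB_le (A := 1) (B := 2) (fun a => ?_) fun ε hε => bracket_le hε.1 fun a _ => ?_).trans
    (by norm_num)
  · refine (lintegral_mono h').trans ?_
    simp [volume_cube a one_pos]
  · simpa using meanOsc_le_of_forall_enorm_sub_le hε.1 hf.integrableOn (c := 0) (A := 1)
      fun x _ => by simpa using h' x

/-! ### Rescaled bumps -/

variable (n) in
/-- A smooth bump on `ℝⁿ` for the supremum norm, equal to `1` on the unit ball and supported in the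
ball of radius `2`. -/
noncomputable def unitBump : ContDiffBump (0 : Fin n → ℝ) := ⟨1, 2, one_pos, one_lt_two⟩

/-- The bump of centre `c` and scale `t`, complex-valued: `1` within distance `t` of `c`, and `0`
from distance `2 * t` on. -/
noncomputable def scaledBump (c : Fin n → ℝ) (t : ℝ) (x : Fin n → ℝ) : ℂ :=
  ((unitBump n (t⁻¹ • (x - c)) : ℝ) : ℂ)

lemma contDiff_scaledBump (c : Fin n → ℝ) (t : ℝ) : ContDiff ℝ ∞ (scaledBump c t) :=
  Complex.ofRealCLM.contDiff.comp
    ((unitBump n).contDiff.comp ((contDiff_id.sub contDiff_const).const_smul t⁻¹))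

lemma norm_inv_smul_sub {t : ℝ} (ht : 0 < t) (x c : Fin n → ℝ) :
    ‖t⁻¹ • (x - c)‖ = dist x c / t := by
  rw [norm_smul, norm_inv, Real.norm_of_nonneg ht.le, dist_eq_norm, inv_mul_eq_div]

lemma scaledBump_eq_one {c : Fin n → ℝ} {t : ℝ} (ht : 0 < t) {x : Fin n → ℝ} (hx : dist x c ≤ t) :
    scaledBump c t x = 1 := by
  have : unitBump n (t⁻¹ • (x - c)) = 1 := (unitBump n).one_of_mem_closedBall <| by
    rw [mem_closedBall_zero_iff, norm_inv_smul_sub ht]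
    exact div_le_one_of_le₀ hx ht.le
  simp [scaledBump, this]

lemma scaledBump_eq_zero {c : Fin n → ℝ} {t : ℝ} (ht : 0 < t) {x : Fin n → ℝ}
    (hx : 2 * t ≤ dist x c) : scaledBump c t x = 0 := by
  have : unitBump n (t⁻¹ • (x - c)) = 0 := (unitBump n).zero_of_le_dist <| by
    rw [dist_zero_right, norm_inv_smul_sub ht]
    exact (le_div_iff₀ ht).2 hx
  simp [scaledBump, this]

lemma norm_scaledBump_le (c : Fin n → ℝ) (t : ℝ) (x : Fin n → ℝ) : ‖scaledBump c t x‖ ≤ 1 := by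
  rw [scaledBump, Complex.norm_real, Real.norm_of_nonneg (unitBump n).nonneg]
  exact (unitBump n).le_one

lemma integrable_scaledBump (c : Fin n → ℝ) {t : ℝ} (ht : 0 < t) :
    Integrable (scaledBump c t) :=
  (contDiff_scaledBump c t).continuous.integrable_of_hasCompactSupport <|
    HasCompactSupport.intro (isCompact_closedBall c (2 * t)) fun x hx =>
      scaledBump_eq_zero ht (by rw [Metric.mem_closedBall, not_le] at hx; exact hx.le)

variable (n) in
lemma exists_norm_scaledBump_sub_le : ∃ L : ℝ, 0 ≤ L ∧ ∀ (c : Fin n → ℝ) (t : ℝ), 0 < t →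
    ∀ x y, ‖scaledBump c t x - scaledBump c t y‖ ≤ L * (dist x y / t) := by
  obtain ⟨L, hL⟩ := ((unitBump n).contDiff (n := 1)).lipschitzWith_of_hasCompactSupport
    (unitBump n).hasCompactSupport one_ne_zero
  refine ⟨L, L.2, fun c t ht x y => ?_⟩
  have := hL.dist_le_mul (t⁻¹ • (x - c)) (t⁻¹ • (y - c))
  rw [scaledBump, scaledBump, ← Complex.ofReal_sub, Complex.norm_real, ← dist_eq_norm]
  refine this.trans_eq ?_
  rw [dist_eq_norm, ← smul_sub, sub_sub_sub_cancel_right, norm_inv_smul_sub ht]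

/-- For the telescoping estimate: `min u u⁻¹` is controlled by an increment of the bounded function
`u ↦ u / (1 + u)` between `u` and `2 * u`. -/
lemma le_six_mul_sub {u m : ℝ} (hu : 0 < u) (h1 : u ≤ 1 → m ≤ u) (h2 : 1 ≤ u → m ≤ 1 / u) :
    m ≤ 6 * (2 * u / (1 + 2 * u) - u / (1 + u)) := by
  have h : 2 * u / (1 + 2 * u) - u / (1 + u) = u / ((1 + u) * (1 + 2 * u)) := by
    field_simp; ring
  rw [h, ← mul_div_assoc, le_div_iff₀ (by positivity)]
  rcases le_total u 1 with hu1 | hu1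
  · nlinarith [mul_le_mul_of_nonneg_right (h1 hu1) (by positivity : 0 ≤ (1 + u) * (1 + 2 * u)),
      mul_nonneg hu.le (sub_nonneg.2 hu1), mul_nonneg (mul_nonneg hu.le hu.le) (sub_nonneg.2 hu1)]
  · refine (mul_le_mul_of_nonneg_right (h2 hu1) (by positivity)).trans ?_
    rw [one_div_mul_eq_div, div_le_iff₀ hu]
    nlinarith

variable (n) in
/-- The mean oscillation of a bump of scale `t` over a cube of side `r` is `O(min (r / t) (t / r))`:
small cubes see the Lipschitz bound, large cubes see the small volume of the support. The bound is
written as an increment, so that it telescopes over dyadic `t`. -/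
lemma exists_meanOsc_scaledBump_le (hn : 1 ≤ n) : ∃ K : ℝ, 0 ≤ K ∧ ∀ (c : Fin n → ℝ) (t : ℝ),
    0 < t → ∀ (a : Fin n → ℝ) (r : ℝ), 0 < r → meanOsc (scaledBump c t) (cube a r) ≤
      ENNReal.ofReal
        (K * (2 * (r / t) / (1 + 2 * (r / t)) - (r / t) / (1 + r / t))) := by
  obtain ⟨L, hL0, hL⟩ := exists_norm_scaledBump_sub_le n
  set K := L + 2 * 4 ^ n + 1 with hK
  have hK0 : 0 < K := by positivity
  refine ⟨K * 6, by positivity, fun c t ht a r hr => ?_⟩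
  have hint := (integrable_scaledBump c ht).integrableOn (s := cube a r)
  have hu : 0 < r / t := by positivity
  have hsmall : meanOsc (scaledBump c t) (cube a r) ≤ ENNReal.ofReal (K * (r / t)) := by
    refine (meanOsc_le_of_forall_enorm_sub_le (c := scaledBump c t a)
      (A := ENNReal.ofReal (L * (r / 2 / t))) hr hint fun x hx => ?_).trans ?_
    · rw [cube_eq_ball a hr, Metric.mem_ball] at hx
      rw [← ofReal_norm]
      refine ENNReal.ofReal_le_ofReal ((hL c t ht x a).trans ?_)
      gcongr
    · rw [← ENNReal.ofReal_ofNat, ← ENNReal.ofReal_mul two_pos.le]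
      refine ENNReal.ofReal_le_ofReal ?_
      have h4 : (0 : ℝ) ≤ (2 * 4 ^ n + 1) * (r / t) := by positivity
      have : 2 * (L * (r / 2 / t)) = L * (r / t) := by ring
      rw [this, hK]; nlinarith
  have hlarge : 1 ≤ r / t →
      meanOsc (scaledBump c t) (cube a r) ≤ ENNReal.ofReal (K * (1 / (r / t))) := by
    intro hu1
    have hball : ∫⁻ x in cube a r, ‖scaledBump c t x‖ₑ ≤ ENNReal.ofReal ((4 * t) ^ n) := by
      calc ∫⁻ x in cube a r, ‖scaledBump c t x‖ₑ
          ≤ ∫⁻ x, ‖scaledBump c t x‖ₑ := setLIntegral_le_lintegral _ _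
        _ ≤ ∫⁻ x, (cube c (4 * t)).indicator 1 x := by
            refine lintegral_mono fun x => ?_
            by_cases hx : x ∈ cube c (4 * t)
            · rw [indicator_of_mem hx, ← ofReal_norm]
              exact ENNReal.ofReal_le_one.2 (norm_scaledBump_le c t x)
            · rw [cube_eq_ball c (by positivity), Metric.mem_ball, not_lt] at hx
              rw [scaledBump_eq_zero ht (by linarith)]
              simp
        _ = ENNReal.ofReal ((4 * t) ^ n) := by
            rw [lintegral_indicator_one (measurableSet_cube c (by positivity)),
              volume_cube c (by positivity)]
    have h := meanOsc_le_two_mul hr hint 0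
    simp only [sub_zero, ProbabilityTheory.cond, lintegral_smul_measure, smul_eq_mul] at h
    refine h.trans ((mul_le_mul_right (mul_le_mul_right hball _) _).trans ?_)
    rw [volume_cube a hr, ← ENNReal.ofReal_inv_of_pos (by positivity),
      ← ENNReal.ofReal_mul (by positivity), ← ENNReal.ofReal_ofNat, ← ENNReal.ofReal_mul two_pos.le]
    refine ENNReal.ofReal_le_ofReal ?_
    have h1 : 2 * ((r ^ n)⁻¹ * (4 * t) ^ n) = 2 * 4 ^ n * (1 / (r / t)) ^ n := by
      rw [one_div_div, div_pow, mul_pow]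
      field_simp
    rw [h1]
    have h2 : (1 / (r / t)) ^ n ≤ 1 / (r / t) :=
      pow_le_of_le_one (by positivity) (div_le_one_of_le₀ hu1 hu.le) (by omega)
    gcongr
    linarith
  refine ENNReal.le_ofReal_iff_toReal_le ?_ ?_ |>.2 ?_
  · exact ne_top_of_le_ne_top ENNReal.ofReal_ne_top hsmall
  · have h := le_six_mul_sub (m := 0) hu (fun _ => hu.le) (fun _ => by positivity)
    nlinarith [mul_nonneg hK0.le h]
  · have h := le_six_mul_sub
      (m := (meanOsc (scaledBump c t) (cube a r)).toReal / K) hu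
      (fun _ => by
        rw [div_le_iff₀' hK0]
        exact ENNReal.toReal_le_of_le_ofReal (by positivity) hsmall)
      (fun h1 => by
        rw [div_le_iff₀' hK0]
        exact ENNReal.toReal_le_of_le_ofReal (by positivity) (hlarge h1))
    rw [div_le_iff₀' hK0] at h
    linarith

/-! ### Cutoffs of small norm -/

/-- Points have zero capacity: there are cutoffs at a point whose norm in `B(ℝⁿ)` is as small as
desired. They are averages of `N` bumps with the same centre and dyadic scales (a smooth version of
a truncated logarithm); every cube sees only boundedly many of these scales, so that the mean
oscillations are `O(1 / N)`. -/
lemma exists_cutoff (hn : 1 ≤ n) (c : Fin n → ℝ) {R : ℝ} (hR : 0 < R) {δ : ℝ≥0} (hδ : 0 < δ) :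
    ∃ (ψ : (Fin n → ℝ) → ℂ) (ρ : ℝ), 0 < ρ ∧ ContDiff ℝ ∞ ψ ∧
      (∀ x ∉ Metric.closedBall c R, ψ x = 0) ∧ (∀ x ∈ Metric.closedBall c ρ, ψ x = 1) ∧
      normB ψ ≤ δ := by
  obtain ⟨K, hK0, hK⟩ := exists_meanOsc_scaledBump_le n hn
  obtain ⟨N, hN⟩ := exists_nat_gt (K / (δ / 2))
  have hδ' : (0 : ℝ) < δ := hδ
  have hN0 : (0 : ℝ) < N := (by positivity : (0 : ℝ) ≤ K / (δ / 2)).trans_lt hN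
  have hNne : (N : ℂ) ≠ 0 := by exact_mod_cast hN0.ne'
  -- The scale `ρ` is so small that the supports have volume at most `δ / 2`.
  obtain ⟨ρ, hρ, hρR, hρ1, hρδ⟩ : ∃ ρ : ℝ, 0 < ρ ∧ 2 * ρ ≤ R ∧ 4 * ρ ≤ 1 ∧ 4 * ρ ≤ δ / 2 := by
    refine ⟨min (R / 2) (min (1 / 4) (δ / 8)), by positivity, ?_, ?_, ?_⟩
    · linarith [min_le_left (R / 2) (min (1 / 4) ((δ : ℝ) / 8))]
    · linarith [(min_le_right (R / 2) _).trans (min_le_left (1 / 4) ((δ : ℝ) / 8))]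
    · linarith [(min_le_right (R / 2) _).trans (min_le_right (1 / 4) ((δ : ℝ) / 8))]
  set t : ℕ → ℝ := fun j => ρ / 2 ^ j with ht
  have ht0 : ∀ j, 0 < t j := fun j => by positivity
  have htρ : ∀ j, t j ≤ ρ := fun j => div_le_self hρ.le (one_le_pow₀ one_le_two)
  set Θ : (Fin n → ℝ) → ℂ := ∑ j ∈ Finset.range N, scaledBump c (t j) with hΘ
  have hzero : ∀ x, 2 * ρ ≤ dist x c → Θ x = 0 := fun x hx => by
    rw [hΘ, Finset.sum_apply]
    exact Finset.sum_eq_zero fun j _ =>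
      scaledBump_eq_zero (ht0 j) (by linarith [htρ j])
  have hint : Integrable Θ := integrable_finsetSum' _ fun j _ => integrable_scaledBump c (ht0 j)
  have hle : ∀ x, ‖(N : ℂ)⁻¹ * Θ x‖ ≤ 1 := fun x => by
    rw [norm_mul, norm_inv, Complex.norm_natCast, inv_mul_le_one₀ hN0, hΘ, Finset.sum_apply]
    refine (norm_sum_le _ _).trans ((Finset.sum_le_sum fun j _ =>
      norm_scaledBump_le c (t j) x).trans ?_)
    simp
  refine ⟨fun x => (N : ℂ)⁻¹ * Θ x, t N, ht0 N, ?_, fun x hx => ?_, fun x hx => ?_, ?_⟩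
  · have : ContDiff ℝ ∞ Θ := by
      rw [hΘ, show (∑ j ∈ Finset.range N, scaledBump c (t j)) =
        fun x => ∑ j ∈ Finset.range N, scaledBump c (t j) x from by ext x; simp]
      exact ContDiff.sum fun j _ => contDiff_scaledBump c (t j)
    exact contDiff_const.mul this
  · rw [Metric.mem_closedBall, not_le] at hx
    simp only
    rw [hzero x (by linarith), mul_zero]
  · have : Θ x = N := by
      rw [hΘ, Finset.sum_apply, Finset.sum_congr rfl fun j hj => scaledBump_eq_one (ht0 j) ?_]
      · simp
      · refine (Metric.mem_closedBall.1 hx).trans ?_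
        have : j ≤ N := (Finset.mem_range.1 hj).le
        simp only [ht]
        gcongr
        norm_num
    simp only
    rw [this, inv_mul_cancel₀ hNne]
  · refine (normB_le (A := ENNReal.ofReal (δ / 2)) (B := ENNReal.ofReal (δ / 2)) (fun a => ?_)
      fun ε hε => bracket_le hε.1 fun a _ => ?_).trans ?_
    · calc ∫⁻ x in cube a 1, ‖(N : ℂ)⁻¹ * Θ x‖ₑ
          ≤ ∫⁻ x, ‖(N : ℂ)⁻¹ * Θ x‖ₑ := setLIntegral_le_lintegral _ _
        _ ≤ ∫⁻ x, (cube c (4 * ρ)).indicator 1 x := by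
            refine lintegral_mono fun x => ?_
            by_cases hx : x ∈ cube c (4 * ρ)
            · rw [indicator_of_mem hx, ← ofReal_norm]
              exact ENNReal.ofReal_le_one.2 (hle x)
            · rw [cube_eq_ball c (by positivity), Metric.mem_ball, not_lt] at hx
              rw [hzero x (by linarith)]
              simp
        _ = ENNReal.ofReal ((4 * ρ) ^ n) := by
            rw [lintegral_indicator_one (measurableSet_cube c (by positivity)),
              volume_cube c (by positivity)]
        _ ≤ ENNReal.ofReal (δ / 2) := ENNReal.ofReal_le_ofReal
            ((pow_le_of_le_one (by positivity) hρ1 (by omega)).trans hρδ)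
    · rw [meanOsc_const_mul]
      set F : ℕ → ℝ := fun j => (ε / t j) / (1 + ε / t j) with hF
      have hstep : ∀ j, 2 * (ε / t j) = ε / t (j + 1) := fun j => by
        simp only [ht, pow_succ]; field_simp
      have hF1 : F N - F 0 ≤ 1 := by
        have hN1 : F N ≤ 1 := by
          have := div_pos hε.1 (ht0 N)
          exact div_le_one_of_le₀ (by linarith) (by linarith)
        have h00 : 0 ≤ F 0 := by
          have := div_pos hε.1 (ht0 0)
          positivity
        linarith
      have hF0 : ∀ j, 0 ≤ F (j + 1) - F j := fun j => by
        have hu := div_pos hε.1 (ht0 j)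
        have h := le_six_mul_sub (m := 0) hu (fun _ => hu.le) (fun _ => by positivity)
        rw [hstep j] at h
        linarith
      have hsum : meanOsc Θ (cube a ε) ≤ ENNReal.ofReal K := by
        calc meanOsc Θ (cube a ε)
            ≤ ∑ j ∈ Finset.range N, meanOsc (scaledBump c (t j)) (cube a ε) :=
              meanOsc_sum_le _ hε.1 fun j _ => (integrable_scaledBump c (ht0 j)).integrableOn
          _ ≤ ∑ j ∈ Finset.range N, ENNReal.ofReal (K * (F (j + 1) - F j)) := by
              refine Finset.sum_le_sum fun j _ => (hK c (t j) (ht0 j) a ε hε.1).trans_eq ?_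
              simp only [hF, hstep j]
          _ = ENNReal.ofReal (K * (F N - F 0)) := by
              rw [← ENNReal.ofReal_sum_of_nonneg fun j _ => mul_nonneg hK0 (hF0 j),
                ← Finset.mul_sum, Finset.sum_range_sub]
          _ ≤ ENNReal.ofReal K := ENNReal.ofReal_le_ofReal (by nlinarith)
      refine (mul_le_mul_right hsum _).trans ?_
      rw [← ofReal_norm, ← ENNReal.ofReal_mul (norm_nonneg _), norm_inv, Complex.norm_natCast]
      refine ENNReal.ofReal_le_ofReal ?_
      rw [inv_mul_le_iff₀ hN0]
      rw [div_lt_iff₀ (by positivity)] at hN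
      linarith
    · rw [← ENNReal.ofReal_add (by positivity) (by positivity), add_halves, ENNReal.ofReal_coe_nnreal]

/-! ### Oscillating blocks -/

/-- Inside every ball there are, for arbitrarily small `ε`, exactly `1 / ε ^ (n - 1)` disjoint
`ε`-cubes: their total volume is only `ε`. -/
lemma exists_disjoint_cubes (hn : 1 ≤ n) (c : Fin n → ℝ) {ρ : ℝ} (hρ : 0 < ρ) {η : ℝ}
    (hη : 0 < η) : ∃ (ε : ℝ) (S : Finset (Fin n → ℝ)), 0 < ε ∧ ε < η ∧
      (∀ a ∈ S, cube a ε ⊆ Metric.closedBall c ρ) ∧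
      (S : Set (Fin n → ℝ)).PairwiseDisjoint (fun a => cube a ε) ∧
      (S.card : ℝ) = 1 / ε ^ (n - 1) := by
  classical
  obtain ⟨p, hp⟩ := exists_nat_gt (max (max (1 / ρ) (1 / η)) 1)
  have hpρ : 1 / ρ < p := ((le_max_left _ _).trans (le_max_left _ _)).trans_lt hp
  have hpη : 1 / η < p := ((le_max_right _ _).trans (le_max_left _ _)).trans_lt hp
  have hp1 : (1 : ℝ) < p := (le_max_right _ _).trans_lt hp
  have hp0 : (0 : ℝ) < p := one_pos.trans hp1
  rw [div_lt_iff₀ hρ] at hpρ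
  rw [div_lt_iff₀ hη] at hpη
  -- `p ^ n` cubes of side `ε` fit on each side of a cube of side `1 / p`.
  set ε : ℝ := 1 / p ^ (n + 1) with hε
  have hε0 : 0 < ε := by positivity
  have hεp : ε * p ^ n = 1 / p := by rw [hε, pow_succ]; field_simp
  have hεη : ε < η := by
    have h1 : ε ≤ 1 / p := by
      rw [← hεp]; exact le_mul_of_one_le_right hε0.le (one_le_pow₀ hp1.le)
    refine h1.trans_lt ?_
    rw [div_lt_iff₀ hp0]; linarith
  let A : (Fin n → Fin (p ^ n)) → Fin n → ℝ := fun v i =>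
    c i - 1 / (2 * p) + ε * ((v i : ℕ) + 1 / 2)
  have hmem : ∀ {v x}, x ∈ cube (A v) ε → ∀ i,
      c i - 1 / (2 * p) + ε * (v i : ℕ) < x i ∧ x i < c i - 1 / (2 * p) + ε * ((v i : ℕ) + 1) := by
    intro v x hx i
    have := abs_lt.1 (hx i)
    simp only [A] at this
    constructor <;> linarith [this.1, this.2]
  have hsep : ∀ {v w x}, x ∈ cube (A v) ε → x ∈ cube (A w) ε → v = w := by
    intro v w x hv hw
    have key : ∀ {v w : Fin n → Fin (p ^ n)}, x ∈ cube (A v) ε → x ∈ cube (A w) ε →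
        ∀ i, (v i : ℕ) ≤ w i := fun {v w} hv hw i => by
      have h1 : ε * (v i : ℕ) < ε * ((w i : ℕ) + 1) := by
        linarith [(hmem hv i).1, (hmem hw i).2]
      have h2 : ((v i : ℕ) : ℝ) < ((w i : ℕ) + 1 : ℕ) := by
        push_cast; exact lt_of_mul_lt_mul_left h1 hε0.le
      exact Nat.lt_succ_iff.1 (by exact_mod_cast h2)
    exact funext fun i => Fin.ext (le_antisymm (key hv hw i) (key hw hv i))
  have hself : ∀ v, A v ∈ cube (A v) ε := fun v i => by simpa using hε0
  have hinj : Function.Injective A := fun v w h => hsep (hself v) (h ▸ hself v)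
  obtain ⟨T, -, hT⟩ := Finset.exists_subset_card_eq
    (s := (Finset.univ : Finset (Fin n → Fin (p ^ n)))) (n := (p ^ (n + 1)) ^ (n - 1)) (by
      rw [Finset.card_univ, Fintype.card_fun, Fintype.card_fin, Fintype.card_fin, ← pow_mul,
        ← pow_mul]
      refine Nat.pow_le_pow_right (by exact_mod_cast hp0) ?_
      obtain ⟨m, rfl⟩ := Nat.exists_eq_add_of_le' hn
      simp only [Nat.add_sub_cancel]
      nlinarith)
  refine ⟨ε, T.image A, hε0, hεη, ?_, ?_, ?_⟩
  · intro a ha x hx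
    obtain ⟨v, -, rfl⟩ := Finset.mem_image.1 ha
    refine (dist_pi_le_iff hρ.le).2 fun i => ?_
    have hv : ((v i : ℕ) : ℝ) + 1 ≤ (p : ℝ) ^ n := by exact_mod_cast (v i).2
    have h1 : ε * ((v i : ℕ) + 1) ≤ 1 / p := by rw [← hεp]; gcongr
    have h2 : 0 ≤ ε * (v i : ℕ) := by positivity
    have h3 : (1 : ℝ) / p = 1 / (2 * p) + 1 / (2 * p) := by field_simp; norm_num
    have h4 : 1 / (2 * (p : ℝ)) ≤ ρ := by
      rw [div_le_iff₀ (by positivity)]; nlinarith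
    rw [Real.dist_eq, abs_le]
    constructor <;> linarith [(hmem hx i).1, (hmem hx i).2]
  · intro a ha b hb hab
    obtain ⟨v, -, rfl⟩ := Finset.mem_image.1 (Finset.mem_coe.1 ha)
    obtain ⟨w, -, rfl⟩ := Finset.mem_image.1 (Finset.mem_coe.1 hb)
    exact Set.disjoint_left.2 fun x hx hy => hab (congrArg A (hsep hx hy))
  · rw [Finset.card_image_of_injective _ hinj, hT, hε]
    push_cast
    rw [div_pow, one_pow, one_div_one_div]

/-- The centre of a subcube of a quarter of the side, in a corner of the cube with centre `a` and
side `r`. -/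
noncomputable def cornerPoint (a : Fin n → ℝ) (r : ℝ) : Fin n → ℝ := fun i => a i + 3 * r / 8

lemma mem_cube_of_mem_quarter {a x : Fin n → ℝ} {r : ℝ} (hr : 0 < r) (hx : x ∈ cube a (r / 4)) :
    x ∈ cube a r := fun i => (hx i).trans (by linarith)

lemma mem_cube_of_mem_corner {a x : Fin n → ℝ} {r : ℝ} (hr : 0 < r)
    (hx : x ∈ cube (cornerPoint a r) (r / 4)) :
    x ∈ cube a r := fun i => by
  have h := abs_lt.1 (hx i)
  simp only [cornerPoint] at h
  exact abs_lt.2 ⟨by linarith, by linarith⟩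

lemma le_dist_of_mem_corner (hn : 1 ≤ n) {a x : Fin n → ℝ} {r : ℝ}
    (hx : x ∈ cube (cornerPoint a r) (r / 4)) : r / 4 ≤ dist x a := by
  refine le_trans ?_ (dist_le_pi_dist x a ⟨0, hn⟩)
  have h := abs_lt.1 (hx ⟨0, hn⟩)
  simp only [cornerPoint] at h
  rw [Real.dist_eq]
  exact le_trans (by linarith) (le_abs_self _)

lemma cond_cube_quarter {a b : Fin n → ℝ} {r : ℝ} (hr : 0 < r)
    (h : cube b (r / 4) ⊆ cube a r) :
    ProbabilityTheory.cond volume (cube a r) (cube b (r / 4)) = ENNReal.ofReal ((1 / 4) ^ n) := by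
  rw [ProbabilityTheory.cond_apply (measurableSet_cube a hr), inter_eq_self_of_subset_right h,
    volume_cube a hr, volume_cube b (by positivity), ← ENNReal.ofReal_inv_of_pos (by positivity),
    ← ENNReal.ofReal_mul (by positivity)]
  rw [div_eq_mul_one_div r, mul_pow, inv_mul_cancel_left₀ (pow_pos hr n).ne']

/-- A test function in a prescribed ball, of norm `O(‖β - α‖)` up to an arbitrarily small error
whatever the size of `α`, which takes both values `α` and `β` on fixed proportions of
`1 / ε ^ (n - 1)` disjoint `ε`-cubes: `α` times a cutoff of small norm, plus `β - α` times a sum of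
disjoint bumps placed where the cutoff is `1`. -/
lemma exists_oscillating_block (hn : 1 ≤ n) (c : Fin n → ℝ) {R : ℝ} (hR : 0 < R) {δ : ℝ≥0}
    (hδ : 0 < δ) {η : ℝ} (hη : 0 < η) (α β : ℂ) :
    ∃ (φ : (Fin n → ℝ) → ℂ) (ε : ℝ) (S : Finset (Fin n → ℝ)), ContDiff ℝ ∞ φ ∧
      (∀ x ∉ Metric.closedBall c R, φ x = 0) ∧ normB φ ≤ δ + 3 * ‖β - α‖ₑ ∧
      0 < ε ∧ ε < η ∧ (∀ a ∈ S, cube a ε ⊆ Metric.closedBall c R) ∧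
      (S : Set (Fin n → ℝ)).PairwiseDisjoint (fun a => cube a ε) ∧
      (S.card : ℝ) = 1 / ε ^ (n - 1) ∧
      ∀ a ∈ S, (∀ x ∈ cube (cornerPoint a ε) (ε / 4), φ x = α) ∧
        ∀ x ∈ cube a (ε / 4), φ x = β := by
  obtain ⟨ψ, ρ, hρ, hψs, hψ0, hψ1, hψn⟩ := exists_cutoff hn c hR (δ := δ / (‖α‖₊ + 1))
    (by positivity)
  obtain ⟨ε, S, hε, hεη, hSρ, hSd, hSc⟩ := exists_disjoint_cubes hn c hρ hη
  have hρR : Metric.closedBall c ρ ⊆ Metric.closedBall c R := fun x hx => by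
    by_contra h
    exact one_ne_zero ((hψ1 x hx).symm.trans (hψ0 x h))
  have hε8 : 0 < ε / 8 := by positivity
  have hbump0 : ∀ b x : Fin n → ℝ, x ∉ cube b ε → scaledBump b (ε / 8) x = 0 := fun b x hx => by
    rw [cube_eq_ball b hε, Metric.mem_ball, not_lt] at hx
    exact scaledBump_eq_zero hε8 (by linarith)
  let χ : (Fin n → ℝ) → ℂ := fun x => ∑ b ∈ S, scaledBump b (ε / 8) x
  -- At most one bump is nonzero at a given point, since the cubes are disjoint.
  have hχ : ∀ a ∈ S, ∀ x ∈ cube a ε, χ x = scaledBump a (ε / 8) x := fun a ha x hx =>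
    Finset.sum_eq_single_of_mem a ha fun b hb hba => hbump0 b x fun hxb =>
      Set.disjoint_left.1 (hSd hb ha hba) hxb hx
  have hχout : ∀ x, (∀ a ∈ S, x ∉ cube a ε) → χ x = 0 := fun x hx =>
    Finset.sum_eq_zero fun b hb => hbump0 b x (hx b hb)
  have hχle : ∀ x, ‖χ x‖ ≤ 1 := fun x => by
    by_cases h : ∃ a ∈ S, x ∈ cube a ε
    · obtain ⟨a, ha, hx⟩ := h
      rw [hχ a ha x hx]
      exact norm_scaledBump_le _ _ _
    · push Not at h
      rw [hχout x h, norm_zero]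
      exact zero_le_one
  have hχs : ContDiff ℝ ∞ χ := ContDiff.sum fun b _ => contDiff_scaledBump b (ε / 8)
  have hχi : Integrable χ := integrable_finsetSum _ fun b _ => integrable_scaledBump b hε8
  have hψi : Integrable ψ := hψs.continuous.integrable_of_hasCompactSupport
    (HasCompactSupport.intro (isCompact_closedBall c R) hψ0)
  have hψone : ∀ a ∈ S, ∀ x ∈ cube a ε, ψ x = 1 := fun a ha x hx => hψ1 x (hSρ a ha hx)
  refine ⟨(fun x => α * ψ x) + fun x => (β - α) * χ x, ε, S,
    (contDiff_const.mul hψs).add (contDiff_const.mul hχs), fun x hx => ?_, ?_, hε, hεη,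
    fun a ha => (hSρ a ha).trans hρR, hSd, hSc, fun a ha => ⟨fun x hx => ?_, fun x hx => ?_⟩⟩
  · simp only [Pi.add_apply]
    rw [hψ0 x hx, hχout x fun a ha hxa => hx (hρR (hSρ a ha hxa))]
    ring
  · refine (normB_add_le (hψi.const_mul α) (hχi.const_mul (β - α))).trans ?_
    rw [normB_const_mul, normB_const_mul, mul_comm _ (normB χ)]
    refine add_le_add ((mul_le_mul_right hψn _).trans ?_)
      (mul_le_mul_left (normB_le_three hχi hχle) _)
    have : ‖α‖₊ * (δ / (‖α‖₊ + 1)) ≤ δ := by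
      rw [mul_div_assoc', div_le_iff₀ (by positivity), mul_comm]
      gcongr
      exact le_self_add
    rw [enorm_eq_nnnorm]
    exact_mod_cast this
  · have hxa := mem_cube_of_mem_corner hε hx
    simp only [Pi.add_apply]
    rw [hψone a ha x hxa, hχ a ha x hxa,
      scaledBump_eq_zero hε8 (by linarith [le_dist_of_mem_corner hn hx])]
    ring
  · have hxa := mem_cube_of_mem_quarter hε hx
    rw [cube_eq_ball a (by positivity), Metric.mem_ball] at hx
    simp only [Pi.add_apply]
    rw [hψone a ha x hxa, hχ a ha x hxa, scaledBump_eq_one hε8 (by linarith)]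
    ring

/-! ### The counterexample for a function that is not uniformly continuous -/

/-- The centres of the blocks, on the diagonal of the unit cube and converging to the origin. -/
noncomputable def blockCentre (n k : ℕ) : Fin n → ℝ := fun _ => 3 / 4 * (1 / 2) ^ k

/-- The radius of the block around `blockCentre n k`, small enough for the blocks to be disjoint. -/
noncomputable def blockRadius (k : ℕ) : ℝ := (1 / 2) ^ k / 8

lemma blockRadius_pos (k : ℕ) : 0 < blockRadius k := by unfold blockRadius; positivity

lemma coord_mem_of_mem_block {k : ℕ} {x : Fin n → ℝ}
    (hx : x ∈ Metric.closedBall (blockCentre n k) (blockRadius k)) (i : Fin n) :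
    5 / 8 * (1 / 2) ^ k ≤ x i ∧ x i ≤ 7 / 8 * (1 / 2) ^ k := by
  have h := (dist_le_pi_dist x _ i).trans (Metric.mem_closedBall.1 hx)
  rw [Real.dist_eq, abs_le, blockCentre, blockRadius] at h
  constructor <;> linarith [h.1, h.2]

lemma block_subset_unitCube (k : ℕ) :
    Metric.closedBall (blockCentre n k) (blockRadius k) ⊆ unitCube n := fun x hx i => by
  have h := coord_mem_of_mem_block hx i
  have h0 : (0 : ℝ) < (1 / 2) ^ k := by positivity
  have h1 : ((1 : ℝ) / 2) ^ k ≤ 1 := pow_le_one₀ (by norm_num) (by norm_num)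
  constructor <;> linarith [h.1, h.2]

lemma eq_of_mem_block (hn : 1 ≤ n) {j k : ℕ} {x : Fin n → ℝ}
    (hj : x ∈ Metric.closedBall (blockCentre n j) (blockRadius j))
    (hk : x ∈ Metric.closedBall (blockCentre n k) (blockRadius k)) : j = k := by
  have key : ∀ {j k : ℕ}, x ∈ Metric.closedBall (blockCentre n j) (blockRadius j) →
      x ∈ Metric.closedBall (blockCentre n k) (blockRadius k) → ¬ j < k := fun {j k} hj hk hjk => by
    have h1 := (coord_mem_of_mem_block hj ⟨0, hn⟩).1
    have h2 := (coord_mem_of_mem_block hk ⟨0, hn⟩).2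
    have h3 : ((1 : ℝ) / 2) ^ k ≤ (1 / 2) ^ (j + 1) :=
      pow_le_pow_of_le_one (by norm_num) (by norm_num) hjk
    have h4 : (0 : ℝ) < (1 / 2) ^ j := by positivity
    rw [pow_succ] at h3
    linarith
  exact le_antisymm (not_lt.1 (key hk hj)) (not_lt.1 (key hj hk))

lemma exists_tsum_nat_add_normB_lt {φ : ℕ → (Fin n → ℝ) → ℂ} (h : ∑' k, normB (φ k) ≠ ⊤) {δ : ℝ≥0∞}
    (hδ : 0 < δ) : ∃ K, ∑' k, normB (φ (k + K)) < δ :=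
  ((ENNReal.tendsto_sum_nat_add (fun k => normB (φ k)) h).eventually_lt_const hδ).exists

lemma sum_mem_testFunctions {ι : Type*} {Ω : Set (Fin n → ℝ)} {φ : ι → (Fin n → ℝ) → ℂ}
    (s : Finset ι) (h : ∀ i ∈ s, φ i ∈ testFunctions Ω) : ∑ i ∈ s, φ i ∈ testFunctions Ω := by
  refine Finset.sum_induction φ (· ∈ testFunctions Ω) (fun u v hu hv => ?_) ?_ h
  · exact ⟨hu.1.add hv.1, hu.2.1.add hv.2.1,
      (tsupport_add u v).trans (union_subset hu.2.2 hv.2.2)⟩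
  · exact ⟨contDiff_const, HasCompactSupport.zero, by simp [tsupport]⟩

/-- The sum of a series of test functions in the unit cube, convergent in the norm of `B(ℝⁿ)`, is a
limit of test functions both in `B(ℝⁿ)` and in `B(Q₀)`. -/
lemma tsum_mem_spaceBc {φ : ℕ → (Fin n → ℝ) → ℂ} (hφ : ∀ k, φ k ∈ testFunctions (unitCube n))
    (hs : ∀ x, Summable fun k => φ k x) (hfin : ∑' k, normB (φ k) ≠ ⊤) :
    (fun x => ∑' k, φ k x) ∈ spaceBc n ∧ (fun x => ∑' k, φ k x) ∈ spaceBcQ n := by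
  set f : (Fin n → ℝ) → ℂ := fun x => ∑' k, φ k x with hf
  have hint : ∀ k, Integrable (φ k) := fun k => integrable_of_mem_testFunctions (hφ k)
  have hfn : normB f < ⊤ := (normB_tsum_le hint hs hfin).trans_lt hfin.lt_top
  have hmeas : StronglyMeasurable f := by
    refine stronglyMeasurable_of_tendsto atTop
      (f := fun N x => ∑ k ∈ Finset.range N, φ k x) (fun N => ?_)
      (tendsto_pi_nhds.2 fun x => (hs x).hasSum.tendsto_sum_nat)
    exact (continuous_finsetSum _ fun k _ => (hφ k).1.continuous).stronglyMeasurable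
  have hcube : ∀ a, IntegrableOn f (cube a 1) := fun a =>
    ⟨hmeas.aestronglyMeasurable, (lintegral_cube_le_normB f a).trans_lt hfn⟩
  have hloc : LocallyIntegrable f := fun x =>
    ⟨cube x 1, by rw [cube_eq_ball x one_pos]; exact Metric.ball_mem_nhds x (by norm_num), hcube x⟩
  have happ : ∀ δ : ℝ≥0∞, 0 < δ → ∃ ψ ∈ testFunctions (unitCube n), normB (f - ψ) < δ := by
    intro δ hδ
    obtain ⟨K, hK⟩ := exists_tsum_nat_add_normB_lt hfin hδ
    refine ⟨∑ k ∈ Finset.range K, φ k, sum_mem_testFunctions _ fun k _ => hφ k, ?_⟩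
    have : f - ∑ k ∈ Finset.range K, φ k = fun x => ∑' k, φ (k + K) x := by
      ext x
      simp only [Pi.sub_apply, hf, Finset.sum_apply, ← (hs x).sum_add_tsum_nat_add K,
        add_sub_cancel_left]
    rw [this]
    refine (normB_tsum_le (fun k => hint (k + K))
      (fun x => (summable_nat_add_iff K).2 (hs x)) ?_).trans_lt hK
    exact (hK.trans_le le_top).ne
  refine ⟨⟨⟨hloc, hfn⟩, fun δ hδ => ?_⟩, ⟨⟨hmeas.aestronglyMeasurable, ?_,
    (normBQ_le_normB f).trans_lt hfn⟩, fun δ hδ => ?_⟩⟩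
  · obtain ⟨ψ, hψ, h⟩ := happ δ hδ
    exact ⟨ψ, ⟨hψ.1, hψ.2.1, subset_univ _⟩, h⟩
  · rw [unitCube_eq_cube]; exact hcube _
  · obtain ⟨ψ, hψ, h⟩ := happ δ hδ
    exact ⟨ψ, hψ, (normBQ_le_normB _).trans_lt h⟩

/-- If `g` is not uniformly continuous, a sum of oscillating blocks between values `x k`, `y k` that
get close while `g (x k)` and `g (y k)` do not is a limit of test functions, but its image under `g`
keeps a fixed mean oscillation on the maximal number of cubes, at arbitrarily small scales. -/
lemma exists_frequently_le_bracket_comp (hn : 1 ≤ n) {g : ℂ → ℂ} (hg : ¬ UniformContinuous g) :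
    ∃ f : (Fin n → ℝ) → ℂ, f ∈ spaceBc n ∧ f ∈ spaceBcQ n ∧ ∃ κ : ℝ≥0∞, 0 < κ ∧
      ∃ᶠ ε in 𝓝[>] (0 : ℝ), κ ≤ bracket (unitCube n) (g ∘ f) ε := by
  rw [Metric.uniformContinuous_iff] at hg
  push Not at hg
  obtain ⟨d, hd, H⟩ := hg
  have hpow : ∀ k : ℕ, (0 : ℝ) < (1 / 2) ^ k := fun k => by positivity
  choose x y hxy hgxy using fun k : ℕ => H ((1 / 2) ^ k) (hpow k)
  choose φ ε S hφs hφ0 hφn hε0 hεlt hSsub hSd hSc hφval using fun k : ℕ =>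
    exists_oscillating_block hn (blockCentre n k) (blockRadius_pos k) (δ := (1 / 2) ^ k)
      (by positivity) (hpow k) (x k) (y k)
  have hφt : ∀ k, φ k ∈ testFunctions (unitCube n) := fun k => by
    have hsupp : tsupport (φ k) ⊆ Metric.closedBall (blockCentre n k) (blockRadius k) :=
      closure_minimal (fun z hz => by_contra fun h => hz (hφ0 k z h)) Metric.isClosed_closedBall
    exact ⟨hφs k, HasCompactSupport.intro (isCompact_closedBall _ _) (hφ0 k),
      hsupp.trans (block_subset_unitCube k)⟩
  -- The blocks are disjoint: at most one term of the series is nonzero at a given point.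
  have hother : ∀ {k z}, z ∈ Metric.closedBall (blockCentre n k) (blockRadius k) →
      ∀ j ≠ k, φ j z = 0 := fun {k z} hz j hj =>
    hφ0 j z fun hzj => hj (eq_of_mem_block hn hzj hz)
  have hs : ∀ z, Summable fun k => φ k z := fun z => by
    by_cases h : ∃ k, z ∈ Metric.closedBall (blockCentre n k) (blockRadius k)
    · obtain ⟨k, hk⟩ := h
      exact (hasSum_single k (hother hk)).summable
    · push Not at h
      simpa only [fun k => hφ0 k z (h k)] using summable_zero
  have hfin : ∑' k, normB (φ k) ≠ ⊤ := by
    have hle : ∀ k, normB (φ k) ≤ ((4 * (1 / 2) ^ k : ℝ≥0) : ℝ≥0∞) := fun k => by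
      refine (hφn k).trans ?_
      have h1 : ‖y k - x k‖₊ ≤ (1 / 2) ^ k := by
        rw [← NNReal.coe_le_coe]
        push_cast
        rw [← dist_eq_norm, dist_comm]
        exact (hxy k).le
      have h2 : (1 / 2) ^ k + 3 * ‖y k - x k‖₊ ≤ 4 * (1 / 2) ^ k := by
        calc (1 / 2) ^ k + 3 * ‖y k - x k‖₊ ≤ (1 / 2) ^ k + 3 * (1 / 2) ^ k := by gcongr
          _ = 4 * (1 / 2) ^ k := by ring
      rw [enorm_eq_nnnorm]
      exact_mod_cast h2
    refine ne_top_of_le_ne_top ?_ (ENNReal.tsum_le_tsum hle)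
    exact ENNReal.tsum_coe_ne_top_iff_summable.2
      ((NNReal.summable_geometric (by norm_num [← NNReal.coe_lt_coe])).mul_left 4)
  obtain ⟨hfc, hfQ⟩ := tsum_mem_spaceBc hφt hs hfin
  have hf : ∀ {k z}, z ∈ Metric.closedBall (blockCentre n k) (blockRadius k) →
      ∑' j, φ j z = φ k z := fun {k z} hz => tsum_eq_single k (hother hz)
  set κ : ℝ≥0∞ := ENNReal.ofReal d * ENNReal.ofReal ((1 / 4) ^ n) with hκ
  have hκ0 : 0 < κ := ENNReal.mul_pos (by simpa using hd) (by simp)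
  have hlow : ∀ k, κ ≤ bracket (unitCube n) (g ∘ fun z => ∑' j, φ j z) (ε k) := fun k => by
    have hadm : IsAdmissible (unitCube n) (ε k) (S k) :=
      ⟨fun a ha => (hSsub k a ha).trans (block_subset_unitCube k), hSd k, (hSc k).le⟩
    refine le_trans ?_ (le_iSup₂ (f := fun (S : Finset (Fin n → ℝ))
      (_ : IsAdmissible (unitCube n) (ε k) S) => ENNReal.ofReal (ε k ^ (n - 1)) *
        ∑ a ∈ S, meanOsc (g ∘ fun z => ∑' j, φ j z) (cube a (ε k))) (S k) hadm)
    have hosc : ∀ a ∈ S k, κ ≤ meanOsc (g ∘ fun z => ∑' j, φ j z) (cube a (ε k)) := fun a ha => by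
      have hε4 : 0 < ε k / 4 := by linarith [hε0 k]
      have hsub1 : cube (cornerPoint a (ε k)) (ε k / 4) ⊆ cube a (ε k) := fun z hz =>
        mem_cube_of_mem_corner (hε0 k) hz
      have hsub2 : cube a (ε k / 4) ⊆ cube a (ε k) := fun z hz =>
        mem_cube_of_mem_quarter (hε0 k) hz
      refine le_trans ?_ (le_meanOsc_of_eqOn (α := g (x k)) (β := g (y k))
        (measurableSet_cube _ hε4) (measurableSet_cube _ hε4)
        (Set.disjoint_left.2 fun z hz hz' => ?_)
        (fun z hz => ?_) (fun z hz => ?_) (cond_cube_quarter (hε0 k) hsub1).ge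
        (cond_cube_quarter (hε0 k) hsub2).ge)
      · rw [hκ, ← ofReal_norm, ← dist_eq_norm]
        gcongr
        exact hgxy k
      · have := le_dist_of_mem_corner hn hz
        rw [cube_eq_ball a hε4, Metric.mem_ball] at hz'
        linarith
      · rw [Function.comp_apply, hf (hSsub k a ha (hsub1 hz)), (hφval k a ha).1 z hz]
      · rw [Function.comp_apply, hf (hSsub k a ha (hsub2 hz)), (hφval k a ha).2 z hz]
    have hone : ENNReal.ofReal (ε k ^ (n - 1)) * ((S k).card : ℝ≥0∞) = 1 := by
      have hp := pow_pos (hε0 k) (n - 1)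
      rw [← ENNReal.ofReal_natCast, hSc k, ← ENNReal.ofReal_mul hp.le, mul_one_div_cancel hp.ne',
        ENNReal.ofReal_one]
    calc κ = ENNReal.ofReal (ε k ^ (n - 1)) * ∑ _a ∈ S k, κ := by
          rw [Finset.sum_const, nsmul_eq_mul, ← mul_assoc, hone, one_mul]
      _ ≤ _ := by gcongr with a ha; exact hosc a ha
  have htend : Tendsto ε atTop (𝓝[>] (0 : ℝ)) := by
    refine tendsto_nhdsWithin_iff.2 ⟨?_, Eventually.of_forall hε0⟩
    exact squeeze_zero (fun k => (hε0 k).le) (fun k => (hεlt k).le)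
      (tendsto_pow_atTop_nhds_zero_of_lt_one (by norm_num) (by norm_num))
  exact ⟨_, hfc, hfQ, κ, hκ0, htend.frequently (Frequently.of_forall hlow)⟩

lemma uniformContinuous_of_forall_limsup_eq_zero (hn : 1 ≤ n) {g : ℂ → ℂ}
    (H : ∀ f : (Fin n → ℝ) → ℂ, f ∈ spaceBc n → f ∈ spaceBcQ n →
      limsup (fun ε : ℝ => bracket (unitCube n) (g ∘ f) ε) (𝓝[>] (0 : ℝ)) = 0) :
    UniformContinuous g := by
  by_contra hg
  obtain ⟨f, hfc, hfQ, κ, hκ, hfreq⟩ := exists_frequently_le_bracket_comp hn hg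
  have := le_limsup_of_frequently_le' hfreq
  rw [H f hfc hfQ] at this
  exact hκ.not_ge this

end BBM

theorem theorem1p2 (n : ℕ) (hn : 1 ≤ n) (g : ℂ → ℂ) (hg : Measurable g) :
    List.TFAE
      [UniformContinuous g,
       BBM.superposition n g '' BBM.spaceB0 n ⊆ BBM.spaceB0 n,
       BBM.superposition n g '' BBM.spaceBc n ⊆ BBM.spaceB0 n,
       BBM.superposition n g '' BBM.spaceB0Q n ⊆ BBM.spaceB0Q n,
       BBM.superposition n g '' BBM.spaceBcQ n ⊆ BBM.spaceB0Q n] ∧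
    (UniformContinuous g →
      (∀ A : Set ((Fin n → ℝ) → ℂ), A ⊆ BBM.spaceB0 n → BBM.IsBoundedFor BBM.normB A →
        BBM.superposition n g '' A ⊆ BBM.spaceB0 n ∧
          BBM.IsBoundedFor BBM.normB (BBM.superposition n g '' A)) ∧
      (∀ A : Set ((Fin n → ℝ) → ℂ), A ⊆ BBM.spaceB0Q n → BBM.IsBoundedFor BBM.normBQ A →
        BBM.superposition n g '' A ⊆ BBM.spaceB0Q n ∧
          BBM.IsBoundedFor BBM.normBQ (BBM.superposition n g '' A))) := by
  have h12 : UniformContinuous g → BBM.superposition n g '' BBM.spaceB0 n ⊆ BBM.spaceB0 n :=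
    fun h => image_subset_iff.2 fun _ hf => BBM.comp_mem_spaceB0 h hf
  have h14 : UniformContinuous g → BBM.superposition n g '' BBM.spaceB0Q n ⊆ BBM.spaceB0Q n :=
    fun h => image_subset_iff.2 fun _ hf => BBM.comp_mem_spaceB0Q h hf
  refine ⟨?_, fun h => ⟨fun A hA hb => ⟨(image_mono hA).trans (h12 h),
    BBM.isBoundedFor_normB_image h hA hb⟩, fun A hA hb => ⟨(image_mono hA).trans (h14 h),
    BBM.isBoundedFor_normBQ_image h hA hb⟩⟩⟩
  tfae_have 1 → 2 := h12
  tfae_have 1 → 4 := h14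
  tfae_have 2 → 3 := fun h => (image_mono BBM.spaceBc_subset_spaceB0).trans h
  tfae_have 4 → 5 := fun h => (image_mono BBM.spaceBcQ_subset_spaceB0Q).trans h
  tfae_have 3 → 1 := fun h =>
    BBM.uniformContinuous_of_forall_limsup_eq_zero hn fun f hf _ =>
      le_antisymm ((limsup_le_limsup (Eventually.of_forall fun ε =>
        BBM.bracket_mono (subset_univ _) (g ∘ f) ε)).trans
          (h (mem_image_of_mem _ hf)).2.le) zero_le
  tfae_have 5 → 1 := fun h =>
    BBM.uniformContinuous_of_forall_limsup_eq_zero hn fun f _ hf => (h (mem_image_of_mem _ hf)).2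
  tfae_finish
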